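/- Let $X$ be a metric space. For $c\in\mathbb N$, a $c$-nice cover of $X$ is a sequence $(\mathcal B_n)_{n\in\mathbb N}$ of families of subsets of $X$ such that: (1) for all $n$ and $U\in\mathcal B_n$, the set $P_{n}(U)=\{V\in\mathcal B_{n+1}: V\subseteq U\}$ is finite; (2) for all $m<n$ and $U\in\mathcal B_n$ there is a unique $V\in\mathcal B_m$ with $U\subseteq V$; (3) for every $r$ there is $\epsilon>0$ such that every $A\subseteq X$ with $0<\mathrm{diam}(A)<\epsilon$ is covered by $c$ sets $U_1,\dots,U_c\in\bigcup_{n>r}\mathcal B_n$ with $\mathrm{diam}(U_i)<c\cdot\mathrm{diam}(A)$. A nice cover is a $c$-nice cover for some $c$. A computable nice cover is a nice cover, with $\mathcal B=\bigcup_n\mathcal B_n$, together with a surjection $\delta:\Sigma^*\to\mathcal B$ for a finite alphabet $\Sigma$ (so $w$ is a name of $\delta(w)$) such that: (4) there is $0<\zeta<1$ with $\mathrm{diam}(U)<\zeta^n$ for all $n$ and $U\in\mathcal B_n$; (5) $\mathrm{diam}\circ\delta$ is a computable real-valued function; (6) from $n$ and any name of any $U\in\mathcal B_n$ one can compute, by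 one algorithm, a finite list of names of the elements of $P_n(U)$; (7) the relations $\delta(v)=\delta(w)$ (on pairs $(v,w)$) and $\delta(w)\in\mathcal B_n$ (on pairs $(n,w)$) are decidable. For $s\in[0,\infty)$ an $s$-supergale is a function $d:\mathcal B\to[0,\infty)$ with $\sum_{U\in\mathcal B_0}d(U)\,\mathrm{diam}(U)^s<\infty$ and $d(U)\,\mathrm{diam}(U)^s\ge\sum_{V\in P_n(U)}d(V)\,\mathrm{diam}(V)^s$ for all $n$ and $U\in\mathcal B_n$ (with $0^0=1$). It is constructive if $d\circ\delta$ is lower semicomputable. It succeeds on $x\in X$ if there are $w_n\in\mathcal B_n$ ($n\in\mathbb N$) with $x\in\bigcap_n w_n$ and $\limsup_n d(w_n)=\infty$. For $A\subseteq X$ let $\mathrm{cdim}(A)\in[0,\infty]$ be the infimum of the $s\in[0,\infty)$ for which some constructive $s$-supergale succeeds on every $x\in A$ (with $\inf\emptyset=\infty$), and $\mathrm{cdim}(x)=\mathrm{cdim}(\{x\})$. Theorem (absolute stability). For every metric space $X$ with a computable nice cover and every $A\subseteq X$, $$\mathrm{cdim}(A)=\sup_{x\in A}\mathrm{cdim}(x),$$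 where the supremum is taken in $[0,\infty]$ (so that $\sup\emptyset=0$). -/

import Mathlib

open scoped NNReal ENNReal

namespace NiceCoverDim

/-! ### Computability notions on names (finite strings over a finite alphabet) -/

/-- A function `g : Σ* → ℝ` with nonnegative values is computable: an algorithm which is given `w`
and `k` outputs the numerator of a dyadic rational `a / 2 ^ k` at distance at most `2 ^ (-k)`
from `g w`. -/
def ComputableReal {α : Type*} [Primcodable α] (g : α → ℝ) : Prop :=
  ∃ a : α × ℕ → ℕ, Computable a ∧
    ∀ w k, |(a (w, k) : ℝ) / 2 ^ k - g w| ≤ 1 / 2 ^ k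

/-- A function `g : Σ* → [0, ∞)` is lower semicomputable: the set of pairs `(w, q)` with `q`
a nonnegative rational and `q < g w` is computably enumerable. The rational `q` is given by a
numerator `p` and a denominator `m + 1`. -/
def LowerSemicomputable {α : Type*} [Primcodable α] (g : α → ℝ≥0) : Prop :=
  REPred fun t : α × ℕ × ℕ => (t.2.1 : ℝ) / (t.2.2 + 1) < (g t.1 : ℝ)

/-! ### Nice covers -/

/-- `(B n)` is a `c`-nice cover of `X`. -/
structure IsNiceCoverWith {X : Type*} [MetricSpace X] (c : ℕ) (B : ℕ → Set (Set X)) : Prop where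
  /-- Decreasing monotonicity. -/
  finite_children : ∀ n, ∀ U ∈ B n, {V | V ∈ B (n + 1) ∧ V ⊆ U}.Finite
  /-- Increasing monotonicity. -/
  unique_parent : ∀ n, ∀ U ∈ B n, ∀ m < n, ∃! V, V ∈ B m ∧ U ⊆ V
  /-- `c`-cover. -/
  cover : ∀ r : ℕ, ∃ ε : ℝ, 0 < ε ∧ ∀ A : Set X,
    0 < Metric.ediam A → Metric.ediam A < ENNReal.ofReal ε →
      ∃ U : Fin c → Set X, (∀ i, ∃ n > r, U i ∈ B n) ∧ A ⊆ ⋃ i, U i ∧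
        ∀ i, Metric.ediam (U i) < c * Metric.ediam A

/-- `(B n)` is a nice cover of `X`. -/
def IsNiceCover {X : Type*} [MetricSpace X] (B : ℕ → Set (Set X)) : Prop :=
  ∃ c : ℕ, IsNiceCoverWith c B

/-- A computable nice cover `(B n)` of `X`, together with a naming `δ` of its elements by the
strings over the finite alphabet `Fin k`. -/
structure ComputableNiceCover (X : Type*) [MetricSpace X] where
  /-- The sequence of covers. -/
  B : ℕ → Set (Set X)
  isNiceCover : IsNiceCover B
  /-- Small size. -/
  small_size : ∃ ζ : ℝ, 0 < ζ ∧ ζ < 1 ∧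
    ∀ n, ∀ U ∈ B n, Metric.ediam U < ENNReal.ofReal (ζ ^ n)
  /-- The size of the alphabet. -/
  k : ℕ
  /-- The naming of the elements of the cover. -/
  δ : List (Fin k) → Set X
  /-- The naming maps onto `⋃ n, B n`; in particular the latter is countable. -/
  range_δ : Set.range δ = ⋃ n, B n
  /-- Names are effective: it is decidable whether two strings name the same set. -/
  decidable_eq : ComputablePred fun p : List (Fin k) × List (Fin k) => δ p.1 = δ p.2
  /-- Names are effective: it is decidable whether a string names an element of `B n`. -/
  decidable_level : ComputablePred fun p : ℕ × List (Fin k) => δ p.2 ∈ B p.1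
  /-- Computable diameter. -/
  computable_diam : ComputableReal fun w => (Metric.ediam (δ w)).toReal
  /-- Computable cover: for `U ∈ B n`, a finite list of names for the elements of
  `{V ∈ B (n + 1) | V ⊆ U}` can be computed from `n` and any name of `U`. -/
  computable_children : ∃ P : ℕ × List (Fin k) → List (List (Fin k)), Computable P ∧
    ∀ n w, δ w ∈ B n → {V | ∃ v ∈ P (n, w), δ v = V} = {V | V ∈ B (n + 1) ∧ V ⊆ δ w}

/-! ### Supergales and constructive dimension -/

/-- `d` is an `s`-supergale for the cover `(B n)`. Only the values of `d` on `⋃ n, B n` matter. -/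
structure IsSupergale {X : Type*} [MetricSpace X] (B : ℕ → Set (Set X)) (s : ℝ≥0)
    (d : Set X → ℝ≥0) : Prop where
  sum_zero : ∑' U : {U // U ∈ B 0}, (d U : ℝ≥0∞) * Metric.ediam (U : Set X) ^ (s : ℝ) < ∞
  sum_children : ∀ n, ∀ U ∈ B n,
    ∑' V : {V // V ∈ B (n + 1) ∧ V ⊆ U}, (d V : ℝ≥0∞) * Metric.ediam (V : Set X) ^ (s : ℝ) ≤
      (d U : ℝ≥0∞) * Metric.ediam U ^ (s : ℝ)

/-- The sequence `w` is a representation of the point `x` for the cover `(B n)`. -/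
def IsRepresentation {X : Type*} (B : ℕ → Set (Set X)) (x : X) (w : ℕ → Set X) : Prop :=
  (∀ n, w n ∈ B n) ∧ x ∈ ⋂ n, w n

/-- The success set of `d`. -/
def successSet {X : Type*} (B : ℕ → Set (Set X)) (d : Set X → ℝ≥0) : Set X :=
  {x | ∃ w, IsRepresentation B x w ∧
    Filter.limsup (fun n => (d (w n) : ℝ≥0∞)) Filter.atTop = ∞}

/-- The set of `s ∈ [0, ∞)` such that some constructive `s`-supergale succeeds on all of `A`. -/
def constrGales {X : Type*} [MetricSpace X] (C : ComputableNiceCover X) (A : Set X) : Set ℝ≥0 :=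
  {s | ∃ d : Set X → ℝ≥0, IsSupergale C.B s d ∧
    LowerSemicomputable (fun w => d (C.δ w)) ∧ A ⊆ successSet C.B d}

/-- The constructive dimension of `A`, with values in `[0, ∞]`: the infimum of the empty set
is `∞`. -/
noncomputable def cdim {X : Type*} [MetricSpace X] (C : ComputableNiceCover X) (A : Set X) : ℝ≥0∞ :=
  ⨅ s ∈ constrGales C A, (s : ℝ≥0∞)

/-- The constructive dimension of a point. -/
noncomputable def cdimPt {X : Type*} [MetricSpace X] (C : ComputableNiceCover X) (x : X) : ℝ≥0∞ :=
  cdim C {x}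

end NiceCoverDim

/-!
The dimension is monotone in the set, so only `cdim C A ≤ ⨆ x ∈ A, cdimPt C x` needs an argument.
Let `t < s` lie above the supremum, with `s` rational. Every `x ∈ A` has its own constructive
supergale of exponent less than `t`, and it suffices to find one constructive `s`-supergale that
succeeds wherever one of these does. The gap between `t` and `s` makes this possible without
enumerating supergales, by counting names instead.

*Counting.* Fix `q` with `3 < q * (s - t)` and `p` with `q * t + 1 ≤ p` and `p + 1 < q * s`. On each
level the weights `d U * diam U ^ t` of a supergale `d` have bounded sum, and a set of diameter
greater than `2 ^ (-q * k)` belongs only to levels below a multiple of `k`. Hence `d` exceeds a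
suitable constant on at most `2 ^ (p * k)` sets of diameter greater than `2 ^ (-q * k)`
(`exists_card_le`). If `d` is constructive, these sets are enumerated by one program on the inputs
`(k, i)` with `i < 2 ^ (p * k)` (`exists_code_enumerating`).

*The universal supergale.* Run all programs `e` on all such inputs `(k, i)` and place the mass
`2 ^ (-(e + 1) - (p + 1) * k)` on the set named by the output. The total mass is finite. Passing the
masses on to all ancestors and dividing by `diam ^ s` gives an `s`-supergale (`univGale`), which is
lower semicomputable because the masses are enumerable and `s` is rational. Where `d` is large, with
`k` least such that `2 ^ (-q * k) < diam U`, its value is at least a constant times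
`diam U ^ ((p + 1) / q - s)` (`exists_le_univGale`). The exponent is negative, so it succeeds where
`d` does (`successSet_subset_univGale`).

Two degenerate situations need care. A set may belong to several levels, and distinct sets of one
level may be comparable. Therefore the relation `Collects` between a mass and the sets at which it is
counted ignores masses on sets which cannot carry any weight (`CanCarry`), and with this convention
a mass is counted at most once on each level (`Collects.unique`). Sets of diameter `0` get the value
`0`; they are irrelevant for success, since a set of diameter `0` containing `x` is `{x}`, at which a
supergale takes a single finite value.
-/

/-! ### Computably enumerable predicates -/

section Computability

variable {α β : Type*} [Primcodable α] [Primcodable β]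

theorem rePred_of_exists {p : α → Prop} {f : α → ℕ → Bool} (hf : Computable₂ f)
    (h : ∀ a, p a ↔ ∃ n, f a n = true) : REPred p := by
  have h1 : Partrec fun a => (Nat.rfind fun n => Part.some (f a n)) := Partrec.rfind hf.partrec₂
  refine h1.dom_re.of_eq fun a => ?_
  refine Nat.rfind_dom.trans ?_
  rw [h a]
  simp

/-- A computably enumerable predicate is the union of an increasing sequence of uniformly
decidable predicates. -/
theorem exists_approx_of_rePred {p : α → Prop} (hp : REPred p) :
    ∃ f : α → ℕ → Bool, Computable₂ f ∧ (∀ a, Monotone (f a)) ∧ ∀ a, p a ↔ ∃ n, f a n = true := by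
  have h1 : Nat.Partrec fun n => Part.bind (Encodable.decode (α := α) n)
      fun a => (Part.assert (p a) fun _ => Part.some ()).map Encodable.encode := hp
  obtain ⟨c, hc⟩ := Nat.Partrec.Code.exists_code.1 h1
  refine ⟨fun a n => (Nat.Partrec.Code.evaln n c (Encodable.encode a)).isSome, ?_, ?_, ?_⟩
  · have h2 : Primrec fun x : α × ℕ => ((x.2, c), Encodable.encode x.1) :=
      (Primrec.snd.pair (Primrec.const c)).pair (Primrec.encode.comp Primrec.fst)
    exact (Primrec.option_isSome.comp (Nat.Partrec.Code.primrec_evaln.comp h2)).to_comp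
  · intro a n m hnm h
    rw [Option.isSome_iff_exists] at h ⊢
    exact h.imp fun x hx => Nat.Partrec.Code.evaln_mono hnm hx
  · intro a
    have h2 : p a ↔ (Nat.Partrec.Code.eval c (Encodable.encode a)).Dom := by
      rw [hc]; simp [Part.assert]
    rw [h2, Part.dom_iff_mem]
    simp only [Nat.Partrec.Code.evaln_complete, Option.isSome_iff_exists]
    exact ⟨fun ⟨y, k, h⟩ => ⟨k, y, h⟩, fun ⟨k, y, h⟩ => ⟨y, k, h⟩⟩

theorem REPred.comp {p : β → Prop} (hp : REPred p) {f : α → β} (hf : Computable f) :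
    REPred fun a => p (f a) :=
  Partrec.comp hp hf

theorem REPred.and {p q : α → Prop} (hp : REPred p) (hq : REPred q) :
    REPred fun a => p a ∧ q a := by
  obtain ⟨f, hf, hfm, hpf⟩ := exists_approx_of_rePred hp
  obtain ⟨g, hg, hgm, hqg⟩ := exists_approx_of_rePred hq
  refine rePred_of_exists (f := fun a n => f a n && g a n)
    (Primrec.and.to_comp.comp₂ hf hg) fun a => ?_
  rw [hpf, hqg]
  simp only [Bool.and_eq_true]
  refine ⟨fun ⟨⟨n, hn⟩, m, hm⟩ => ⟨max n m, ?_, ?_⟩, fun ⟨n, h1, h2⟩ => ⟨⟨n, h1⟩, n, h2⟩⟩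
  · exact hfm a (le_max_left n m) hn
  · exact hgm a (le_max_right n m) hm

theorem REPred.or {p q : α → Prop} (hp : REPred p) (hq : REPred q) :
    REPred fun a => p a ∨ q a := by
  obtain ⟨f, hf, hfm, hpf⟩ := exists_approx_of_rePred hp
  obtain ⟨g, hg, hgm, hqg⟩ := exists_approx_of_rePred hq
  refine rePred_of_exists (f := fun a n => f a n || g a n)
    (Primrec.or.to_comp.comp₂ hf hg) fun a => ?_
  rw [hpf, hqg]
  simp only [Bool.or_eq_true, exists_or]

theorem REPred.exists {r : α × β → Prop} (hr : REPred r) : REPred fun a => ∃ b, r (a, b) := by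
  obtain ⟨f, hf, hfm, hrf⟩ := exists_approx_of_rePred hr
  refine rePred_of_exists (f := fun a n =>
    ((Encodable.decode (α := β) n.unpair.1).map fun b => f (a, b) n.unpair.2).getD false) ?_ ?_
  · have hu : Computable fun x : α × ℕ => x.2.unpair := Computable.unpair.comp Computable.snd
    refine Computable.option_getD (Computable.option_map
      (Computable.decode.comp (Computable.fst.comp hu)) ?_) (Computable.const false)
    refine hf.comp ((Computable.fst.comp Computable.fst).pair Computable.snd)
      (Computable.snd.comp (hu.comp Computable.fst))
  · intro a
    constructor
    · rintro ⟨b, hb⟩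
      obtain ⟨n, hn⟩ := (hrf _).1 hb
      exact ⟨Nat.pair (Encodable.encode b) n, by simpa using hn⟩
    · rintro ⟨n, hn⟩
      cases hd : Encodable.decode (α := β) n.unpair.1 with
      | none => simp [hd] at hn
      | some b => exact ⟨b, (hrf _).2 ⟨n.unpair.2, by simpa [hd] using hn⟩⟩

theorem ComputablePred.comp {p : β → Prop} (hp : ComputablePred p) {f : α → β}
    (hf : Computable f) : ComputablePred fun a => p (f a) := by
  obtain ⟨g, hg, rfl⟩ := ComputablePred.computable_iff.1 hp
  exact ComputablePred.computable_iff.2 ⟨_, hg.comp hf, rfl⟩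

theorem computable_pow : Computable₂ fun a b : ℕ => a ^ b := by
  have h : Computable fun x : ℕ × ℕ =>
      (Nat.rec 1 (fun _ r => r * x.1) x.2 : ℕ) :=
    Computable.nat_rec (h := fun x y => y.2 * x.1) Computable.snd (Computable.const 1)
      (Primrec.nat_mul.to_comp.comp (Computable.snd.comp Computable.snd)
        (Computable.fst.comp Computable.fst))
  refine h.of_eq fun x => ?_
  induction x.2 with
  | zero => simp
  | succ n ih => simp [pow_succ, ih]

theorem computable_sum_range {f : α → ℕ → ℕ} (hf : Computable₂ f) :
    Computable₂ fun a n => ∑ i ∈ Finset.range n, f a i := by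
  have h : Computable fun x : α × ℕ => (Nat.rec 0 (fun i r => r + f x.1 i) x.2 : ℕ) :=
    Computable.nat_rec (h := fun x y => y.2 + f x.1 y.1) Computable.snd (Computable.const 0)
      (Primrec.nat_add.to_comp.comp (Computable.snd.comp Computable.snd)
        (hf.comp (Computable.fst.comp Computable.fst) (Computable.fst.comp Computable.snd)))
  refine h.of_eq fun x => ?_
  induction x.2 with
  | zero => simp
  | succ n ih =>
    simp only at ih ⊢
    rw [Finset.sum_range_succ, ← ih]

theorem rePred_lt {f g : α → ℕ} (hf : Computable f) (hg : Computable g) :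
    REPred fun a => f a < g a :=
  (ComputablePred.comp (p := fun x : ℕ × ℕ => x.1 < x.2)
    (PrimrecPred.computablePred Primrec.nat_lt) (hf.pair hg)).to_re

end Computability

/-! ### Lower semicomputable series and quotients -/

open Filter Topology in
/-- The sum of the dyadic weights `2 ^ (-g n)` of the indices `n` for which a computably enumerable
predicate holds is approximated from below by a computable sequence of dyadic rationals. -/
theorem exists_dyadic_approx {α : Type*} [Primcodable α] {r : α × ℕ → Prop} [DecidablePred r]
    (hr : REPred r) {g : ℕ → ℕ} (hg : Computable g)
    (hs : ∀ a, Summable fun n => if r (a, n) then ((1 : ℝ) / 2) ^ g n else 0) :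
    ∃ N : α → ℕ → ℕ, Computable₂ N ∧
      (∀ a T, (N a T : ℝ) / 2 ^ T ≤ ∑' n, if r (a, n) then ((1 : ℝ) / 2) ^ g n else 0) ∧
      ∀ a, Tendsto (fun T => (N a T : ℝ) / 2 ^ T) atTop
        (𝓝 (∑' n, if r (a, n) then ((1 : ℝ) / 2) ^ g n else 0)) := by
  obtain ⟨f, hf, hfm, hfr⟩ := exists_approx_of_rePred hr
  -- at stage `T`, the weight of `n`, multiplied by `2 ^ T`, if it has been confirmed by then
  let h : α × ℕ → ℕ → ℕ := fun x n =>
    cond (f (x.1, n) x.2 && decide (g n ≤ x.2)) (2 ^ (x.2 - g n)) 0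
  have hh : Computable₂ h := by
    have h1 : Computable fun y : (α × ℕ) × ℕ => g y.2 := hg.comp Computable.snd
    have h2 : Computable fun y : (α × ℕ) × ℕ => y.1.2 := Computable.snd.comp Computable.fst
    refine Computable.cond (Primrec.and.to_comp.comp (hf.comp
      ((Computable.fst.comp Computable.fst).pair Computable.snd) h2) ?_) ?_ (Computable.const 0)
    · exact (PrimrecRel.decide Primrec.nat_le).to_comp.comp h1 h2
    · exact computable_pow.comp (Computable.const 2) (Primrec.nat_sub.to_comp.comp h2 h1)
  have hval : ∀ a T n, (h (a, T) n : ℝ) / 2 ^ T =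
      if f (a, n) T = true ∧ g n ≤ T then ((1 : ℝ) / 2) ^ g n else 0 := by
    intro a T n
    by_cases hc : f (a, n) T = true ∧ g n ≤ T
    · have : (2 : ℝ) ^ T = 2 ^ (T - g n) * 2 ^ g n := by rw [← pow_add, Nat.sub_add_cancel hc.2]
      simp only [h, hc, decide_true, Bool.and_self, cond_true, Nat.cast_pow, Nat.cast_ofNat, this,
        and_self, if_true, one_div, inv_pow]
      field_simp
    · rw [if_neg hc]
      have : (f (a, n) T && decide (g n ≤ T)) = false := by
        rw [← Bool.not_eq_true]; simpa using hc
      simp [h, this]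
  let N : α → ℕ → ℕ := fun a T => ∑ n ∈ Finset.range T, h (a, T) n
  have hNv : ∀ a T, (N a T : ℝ) / 2 ^ T = ∑ n ∈ Finset.range T,
      if f (a, n) T = true ∧ g n ≤ T then ((1 : ℝ) / 2) ^ g n else 0 := by
    intro a T
    simp only [N, Nat.cast_sum, Finset.sum_div, hval]
  have hle : ∀ a T, (N a T : ℝ) / 2 ^ T ≤
      ∑' n, if r (a, n) then ((1 : ℝ) / 2) ^ g n else 0 := by
    intro a T
    rw [hNv]
    refine le_trans (Finset.sum_le_sum fun n _ => ?_)
      ((hs a).sum_le_tsum (Finset.range T) fun n _ => by positivity)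
    split_ifs with h1 h2 h2
    · exact le_rfl
    · exact absurd ((hfr _).2 ⟨T, h1.1⟩) h2
    · positivity
    · exact le_rfl
  refine ⟨N, ?_, hle, fun a => ?_⟩
  · exact (computable_sum_range hh).comp Computable.id Computable.snd
  · refine tendsto_order.2 ⟨fun x hx => ?_, fun x hx => Eventually.of_forall fun T =>
      (hle a T).trans_lt hx⟩
    obtain ⟨T₀, hT₀⟩ := ((hs a).hasSum.tendsto_sum_nat.eventually (lt_mem_nhds hx)).exists
    have h1 : ∀ n, ∀ᶠ T in atTop, r (a, n) → f (a, n) T = true ∧ g n ≤ T := by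
      intro n
      by_cases hrn : r (a, n)
      · obtain ⟨t, ht⟩ := (hfr _).1 hrn
        filter_upwards [eventually_ge_atTop t, eventually_ge_atTop (g n)] with T h1 h2 _
        exact ⟨hfm _ h1 ht, h2⟩
      · exact Eventually.of_forall fun T h => absurd h hrn
    have h2 : ∀ᶠ T in atTop, ∀ n ∈ Finset.range T₀, r (a, n) → f (a, n) T = true ∧ g n ≤ T :=
      (Finset.eventually_all _).2 fun n _ => h1 n
    filter_upwards [h2, eventually_ge_atTop T₀] with T hT hTT
    refine hT₀.trans_le ?_
    rw [hNv]
    refine le_trans (Finset.sum_le_sum fun n hn => ?_) (Finset.sum_le_sum_of_subset_of_nonneg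
      (Finset.range_mono hTT) fun n _ _ => by positivity)
    by_cases hrn : r (a, n)
    · rw [if_pos hrn, if_pos (hT n hn hrn)]
    · rw [if_neg hrn]; positivity

open Filter Topology in
/-- If `μ` is approximated from below and `D` is computable, then `μ / D ^ s` is lower
semicomputable for rational `s = A / B` on the set where `D` is positive. -/
theorem rePred_lt_div_rpow {α : Type*} [Primcodable α] {μ D : α → ℝ} {N : α → ℕ → ℕ}
    (hN : Computable₂ N) (hle : ∀ a T, (N a T : ℝ) / 2 ^ T ≤ μ a)
    (hlim : ∀ a, Tendsto (fun T => (N a T : ℝ) / 2 ^ T) atTop (𝓝 (μ a)))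
    (hD : NiceCoverDim.ComputableReal D) (A B : ℕ) (hB : B ≠ 0) :
    REPred fun t : α × ℕ × ℕ =>
      0 < D t.1 ∧ (t.2.1 : ℝ) / (t.2.2 + 1) < μ t.1 / D t.1 ^ ((A : ℝ) / B) := by
  obtain ⟨u, hu, hub⟩ := hD
  have hμ0 : ∀ a, 0 ≤ μ a := fun a => le_trans (by positivity) (hle a 0)
  have hlow : ∀ a T, ((u (a, T) : ℝ) - 1) / 2 ^ T ≤ D a := fun a T => by
    have := (abs_le.1 (hub a T)).2
    rw [sub_div]; linarith
  have hupp : ∀ a T, D a ≤ ((u (a, T) : ℝ) + 1) / 2 ^ T := fun a T => by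
    have := (abs_le.1 (hub a T)).1
    rw [add_div]; linarith
  have h2 : Tendsto (fun T : ℕ => (1 : ℝ) / 2 ^ T) atTop (𝓝 0) := by
    simpa [one_div, inv_pow] using
      tendsto_pow_atTop_nhds_zero_of_lt_one (r := (1 / 2 : ℝ)) (by norm_num) (by norm_num)
  have hulim : ∀ a, Tendsto (fun T => (u (a, T) : ℝ) / 2 ^ T) atTop (𝓝 (D a)) := fun a => by
    rw [tendsto_iff_dist_tendsto_zero]
    exact squeeze_zero (fun _ => dist_nonneg) (fun T => hub a T) h2
  have hulim1 : ∀ a, Tendsto (fun T => ((u (a, T) : ℝ) - 1) / 2 ^ T) atTop (𝓝 (D a)) := fun a => by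
    simpa [sub_div] using (hulim a).sub h2
  have hulim2 : ∀ a, Tendsto (fun T => ((u (a, T) : ℝ) + 1) / 2 ^ T) atTop (𝓝 (D a)) := fun a => by
    simpa [add_div] using (hulim a).add h2
  have key : ∀ (D' q μ' : ℝ), 0 < D' → 0 ≤ q → 0 ≤ μ' →
      (q < μ' / D' ^ ((A : ℝ) / B) ↔ q ^ B * D' ^ A < μ' ^ B) := by
    intro D' q μ' h1 hq hμ'
    rw [lt_div_iff₀ (by positivity), ← pow_lt_pow_iff_left₀ (by positivity) hμ' hB, mul_pow,
      ← Real.rpow_mul_natCast h1.le, div_mul_cancel₀ _ (by exact_mod_cast hB), Real.rpow_natCast]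
  have key2 : ∀ (p m a n T : ℕ),
      p ^ B * (a + 1) ^ A * 2 ^ (T * B) < n ^ B * (m + 1) ^ B * 2 ^ (T * A) ↔
      ((p : ℝ) / (m + 1)) ^ B * (((a : ℝ) + 1) / 2 ^ T) ^ A < ((n : ℝ) / 2 ^ T) ^ B := by
    intro p m a n T
    rw [← Nat.cast_lt (α := ℝ)]
    push_cast
    rw [div_pow, div_pow, div_pow, ← pow_mul, ← pow_mul, div_mul_div_comm,
      div_lt_div_iff₀ (by positivity) (by positivity),
      show (n : ℝ) ^ B * ((m + 1) ^ B * 2 ^ (T * A)) = n ^ B * (m + 1) ^ B * 2 ^ (T * A) by ring]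
  -- the test at precision `T`, with denominators cleared; `1 < u (a, T)` certifies `0 < D a`
  let cmp : (α × ℕ × ℕ) × ℕ → Prop := fun x => 1 < u (x.1.1, x.2) ∧
    x.1.2.1 ^ B * (u (x.1.1, x.2) + 1) ^ A * 2 ^ (x.2 * B) <
      N x.1.1 x.2 ^ B * (x.1.2.2 + 1) ^ B * 2 ^ (x.2 * A)
  have hcmp : REPred cmp := by
    have ca : Computable fun x : (α × ℕ × ℕ) × ℕ => x.1.1 := Computable.fst.comp Computable.fst
    have cp : Computable fun x : (α × ℕ × ℕ) × ℕ => x.1.2.1 :=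
      Computable.fst.comp (Computable.snd.comp Computable.fst)
    have cm : Computable fun x : (α × ℕ × ℕ) × ℕ => x.1.2.2 :=
      Computable.snd.comp (Computable.snd.comp Computable.fst)
    have cT : Computable fun x : (α × ℕ × ℕ) × ℕ => x.2 := Computable.snd
    have cu : Computable fun x : (α × ℕ × ℕ) × ℕ => u (x.1.1, x.2) := hu.comp (ca.pair cT)
    have cN : Computable fun x : (α × ℕ × ℕ) × ℕ => N x.1.1 x.2 := hN.comp ca cT
    have mul : Computable₂ fun a b : ℕ => a * b := Primrec.nat_mul.to_comp
    refine (rePred_lt (Computable.const 1) cu).and (rePred_lt ?_ ?_)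
    · exact mul.comp (mul.comp (computable_pow.comp cp (Computable.const B))
        (computable_pow.comp (Computable.succ.comp cu) (Computable.const A)))
        (computable_pow.comp (Computable.const 2) (mul.comp cT (Computable.const B)))
    · exact mul.comp (mul.comp (computable_pow.comp cN (Computable.const B))
        (computable_pow.comp (Computable.succ.comp cm) (Computable.const B)))
        (computable_pow.comp (Computable.const 2) (mul.comp cT (Computable.const A)))
  refine hcmp.exists.of_eq fun ⟨a, p, m⟩ => ?_
  simp only [cmp, key2]
  constructor
  · rintro ⟨T, h1, h2⟩
    have hpos : 0 < D a := lt_of_lt_of_le (by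
      have : (1 : ℝ) < u (a, T) := by exact_mod_cast h1
      have : (0 : ℝ) < u (a, T) - 1 := by linarith
      positivity) (hlow a T)
    refine ⟨hpos, (key _ _ _ hpos (by positivity) (hμ0 a)).2 ?_⟩
    calc ((p : ℝ) / (m + 1)) ^ B * D a ^ A
        ≤ ((p : ℝ) / (m + 1)) ^ B * (((u (a, T) : ℝ) + 1) / 2 ^ T) ^ A := by
          gcongr
          exact hupp a T
      _ < ((N a T : ℝ) / 2 ^ T) ^ B := h2
      _ ≤ μ a ^ B := by
          gcongr
          exact hle a T
  · rintro ⟨hpos, hlt⟩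
    rw [key _ _ _ hpos (by positivity) (hμ0 a)] at hlt
    have e1 := ((hulim1 a).eventually (lt_mem_nhds hpos))
    have e2 := (((hulim2 a).pow A).const_mul (((p : ℝ) / (m + 1)) ^ B)).eventually_lt
      ((hlim a).pow B) hlt
    obtain ⟨T, h1, h2⟩ := (e1.and e2).exists
    refine ⟨T, ?_, h2⟩
    have : (0 : ℝ) < u (a, T) - 1 := by
      by_contra hc
      exact absurd h1 (not_lt.2 (div_nonpos_of_nonpos_of_nonneg (not_lt.1 hc) (by positivity)))
    have : (1 : ℝ) < u (a, T) := by linarith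
    exact_mod_cast this

/-! ### Enumeration of finite sets by programs -/

/-- Uniform enumeration of finite sets: if for every `k` at most `A k` objects have a name `w` with
`R (k, w)`, then one program maps every pair `(k, i)` with `i < A k` to at most one name, such that
all these objects are reached. Objects are given by names, whose equality `δ v = δ w` is decidable,
so that repetitions can be skipped during the enumeration. -/
theorem exists_code_enumerating {β σ : Type*} [Primcodable β] {R : ℕ × β → Prop}
    (hR : REPred R) {δ : β → σ} (hδ : ComputablePred fun p : β × β => δ p.1 = δ p.2)
    {A : ℕ → ℕ}
    (hA : ∀ k, ∀ S : Finset σ, (∀ U ∈ S, ∃ w, R (k, w) ∧ δ w = U) → S.card ≤ A k) :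
    ∃ c : Nat.Partrec.Code, ∀ k w, R (k, w) → ∃ i < A k, ∃ v, δ v = δ w ∧
      Encodable.encode v ∈ c.eval (Nat.pair k i) := by
  classical
  obtain ⟨f, hf, -, hfR⟩ := exists_approx_of_rePred hR
  obtain ⟨e, he, hδe⟩ := ComputablePred.computable_iff.1 hδ
  have hδe' : ∀ v w, e (v, w) = true ↔ δ v = δ w := fun v w => by
    have := congrFun hδe (v, w); simp only at this; rw [this]
  -- `y` encodes a name together with the time at which it is enumerated
  let nm : ℕ → Option β := fun y => Encodable.decode y.unpair.1
  let Q : ℕ → ℕ → Bool := fun k y => ((nm y).map fun w => f (k, w) y.unpair.2).getD false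
  let same : ℕ → ℕ → Bool := fun y y' =>
    ((nm y).bind fun v => (nm y').map fun w => e (v, w)).getD false
  let rep : ℕ × ℕ → ℕ → ℕ := fun x y' => cond (Q x.1 y' && same y' x.2) 1 0
  -- `y` is new if no earlier `y'` enumerates the same object
  let new : ℕ → ℕ → Bool := fun k y =>
    Q k y && decide (∑ y' ∈ Finset.range y, rep (k, y) y' = 0)
  -- the `i`-th object of the enumeration is the one at the new `y` with `idx k y = i`
  let idx : ℕ → ℕ → ℕ := fun k y => ∑ y' ∈ Finset.range y, cond (new k y') 1 0
  have cnm : Computable nm := Computable.decode.comp (Computable.fst.comp Computable.unpair)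
  have cQ : Computable₂ Q := by
    refine Computable.option_getD (Computable.option_map (cnm.comp Computable.snd) ?_)
      (Computable.const false)
    exact hf.comp ((Computable.fst.comp Computable.fst).pair Computable.snd)
      (Computable.snd.comp (Computable.unpair.comp (Computable.snd.comp Computable.fst)))
  have csame : Computable₂ same := by
    refine Computable.option_getD (Computable.option_bind (cnm.comp Computable.fst) ?_)
      (Computable.const false)
    refine Computable.option_map (cnm.comp (Computable.snd.comp Computable.fst)) ?_
    exact he.comp ((Computable.snd.comp Computable.fst).pair Computable.snd)
  have crep : Computable₂ rep := by
    refine Computable.cond (Primrec.and.to_comp.comp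
      (cQ.comp (Computable.fst.comp Computable.fst) Computable.snd)
      (csame.comp Computable.snd (Computable.snd.comp Computable.fst)))
      (Computable.const 1) (Computable.const 0)
  have cnew : Computable₂ new := by
    refine Primrec.and.to_comp.comp cQ ?_
    exact (PrimrecRel.decide (Primrec.eq (α := ℕ))).to_comp.comp
      ((computable_sum_range crep).comp Computable.id Computable.snd) (Computable.const 0)
  have cidx : Computable₂ idx := computable_sum_range
    (Computable.cond cnew (Computable.const 1) (Computable.const 0))
  let out : ℕ → ℕ := fun y => ((nm y).map Encodable.encode).getD 0
  have cout : Computable out := Computable.option_getD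
    (Computable.option_map cnm (Computable.encode.comp Computable.snd)) (Computable.const 0)
  let test : ℕ → ℕ → Bool := fun x y => new x.unpair.1 y && decide (idx x.unpair.1 y = x.unpair.2)
  have ctest : Computable₂ test := by
    have c1 : Computable fun z : ℕ × ℕ => z.1.unpair := Computable.unpair.comp Computable.fst
    refine Primrec.and.to_comp.comp (cnew.comp (Computable.fst.comp c1) Computable.snd) ?_
    exact (PrimrecRel.decide (Primrec.eq (α := ℕ))).to_comp.comp
      (cidx.comp (Computable.fst.comp c1) Computable.snd) (Computable.snd.comp c1)
  have cF : Partrec fun x : ℕ => (Nat.rfind fun y => Part.some (test x y)).map out :=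
    (Partrec.rfind ctest.partrec₂).map (cout.comp Computable.snd)
  obtain ⟨c, hc⟩ := Nat.Partrec.Code.exists_code.1 (Partrec.nat_iff.1 cF)
  have hQ : ∀ k y, Q k y = true ↔ ∃ w, nm y = some w ∧ f (k, w) y.unpair.2 = true := by
    intro k y
    cases h : nm y <;> simp [Q, h]
  have hsame : ∀ y y', same y y' = true ↔ ∃ v w, nm y = some v ∧ nm y' = some w ∧ δ v = δ w := by
    intro y y'
    cases h : nm y <;> cases h' : nm y' <;> simp [same, h, h', hδe']
  have hnew : ∀ k y, new k y = true ↔ Q k y = true ∧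
      ∀ y' < y, Q k y' = true → ¬ same y' y = true := by
    intro k y
    simp only [new, Bool.and_eq_true, decide_eq_true_eq, Finset.sum_eq_zero_iff, Finset.mem_range]
    refine and_congr_right fun _ => forall₂_congr fun y' _ => ?_
    cases h : Q k y' <;> cases h' : same y' y <;> simp [rep, h, h']
  have hidx : ∀ k y, idx k y = ((Finset.range y).filter fun y' => new k y' = true).card := by
    intro k y
    rw [Finset.card_filter]
    refine Finset.sum_congr rfl fun y' _ => ?_
    cases new k y' <;> simp
  have hidx_lt : ∀ k y y', y' < y → new k y' = true → idx k y' < idx k y := by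
    intro k y y' h hn
    rw [hidx, hidx]
    refine Finset.card_lt_card (Finset.ssubset_iff_of_subset ?_ |>.2 ⟨y', ?_, ?_⟩)
    · exact Finset.filter_subset_filter _ (Finset.range_mono h.le)
    · simp [h, hn]
    · simp
  have hidx_A : ∀ k y, new k y = true → idx k y < A k := by
    intro k y hy
    have h1 : ((Finset.range (y + 1)).filter fun y' => new k y' = true).card ≤ A k := by
      let S : Finset (Option σ) :=
        ((Finset.range (y + 1)).filter fun y' => new k y' = true).image fun y' => (nm y').map δ
      have hinj : Set.InjOn (fun y' => (nm y').map δ)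
          ((Finset.range (y + 1)).filter fun y' => new k y' = true : Finset ℕ) := by
        intro y₁ h₁ y₂ h₂ heq
        have n₁ := (hnew k y₁).1 (by simpa using (Finset.mem_filter.1 h₁).2)
        have n₂ := (hnew k y₂).1 (by simpa using (Finset.mem_filter.1 h₂).2)
        obtain ⟨w₁, e₁, -⟩ := (hQ _ _).1 n₁.1
        obtain ⟨w₂, e₂, -⟩ := (hQ _ _).1 n₂.1
        simp only [e₁, e₂, Option.map_some, Option.some.injEq] at heq
        rcases lt_trichotomy y₁ y₂ with h | h | h
        · exact absurd ((hsame _ _).2 ⟨_, _, e₁, e₂, heq⟩) (n₂.2 _ h n₁.1)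
        · exact h
        · exact absurd ((hsame _ _).2 ⟨_, _, e₂, e₁, heq.symm⟩) (n₁.2 _ h n₂.1)
      have hcard : S.card = _ := Finset.card_image_of_injOn hinj
      rw [← hcard]
      have hS : S.eraseNone.card = S.card := by
        refine Finset.card_eraseNone_of_not_mem ?_
        intro hmem
        obtain ⟨y', hy', hnone⟩ := Finset.mem_image.1 hmem
        obtain ⟨w, e, -⟩ := (hQ _ _).1 ((hnew k y').1 (Finset.mem_filter.1 hy').2).1
        simp [e] at hnone
      rw [← hS]
      refine hA k _ fun U hU => ?_
      obtain ⟨y', hy', hU⟩ := Finset.mem_image.1 (Finset.mem_eraseNone.1 hU)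
      obtain ⟨w, e, hw⟩ := (hQ _ _).1 ((hnew k y').1 (Finset.mem_filter.1 hy').2).1
      simp only [e, Option.map_some, Option.some.injEq] at hU
      exact ⟨w, (hfR _).2 ⟨_, hw⟩, hU⟩
    refine lt_of_lt_of_le ?_ h1
    rw [← hidx]
    exact hidx_lt k _ _ (Nat.lt_succ_self y) hy
  refine ⟨c, fun k w hw => ?_⟩
  have hex : ∃ y, Q k y = true ∧ ∃ v, nm y = some v ∧ δ v = δ w := by
    obtain ⟨t, ht⟩ := (hfR _).1 hw
    have : nm (Nat.pair (Encodable.encode w) t) = some w := by simp [nm]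
    exact ⟨Nat.pair (Encodable.encode w) t, (hQ _ _).2 ⟨w, this, by simpa using ht⟩, w, this, rfl⟩
  obtain ⟨h1, v, h2, h3⟩ := Nat.find_spec hex
  set y := Nat.find hex with hy
  have hynew : new k y = true := by
    refine (hnew k y).2 ⟨h1, fun y' hy' hQ' hs => ?_⟩
    obtain ⟨v₁, v₂, e₁, e₂, h⟩ := (hsame _ _).1 hs
    rw [h2, Option.some.injEq] at e₂
    exact Nat.find_min hex hy' ⟨hQ', v₁, e₁, by rw [h, ← e₂, h3]⟩
  refine ⟨idx k y, hidx_A k y hynew, v, h3, ?_⟩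
  rw [hc]
  refine (Part.mem_map_iff _).2 ⟨y, Nat.mem_rfind.2 ⟨?_, fun {m} hm => ?_⟩, by simp [out, h2]⟩
  · simp [test, hynew]
  · simp only [test, Nat.unpair_pair, Part.mem_some_iff]
    symm
    rw [Bool.and_eq_false_iff]
    by_cases hn : new k m = true
    · right
      simpa using (hidx_lt k _ _ hm hn).ne
    · left
      simpa using hn

namespace NiceCoverDim

/-! ### Ancestors in a nice cover -/

section Ancestors

variable {X : Type*} {B : ℕ → Set (Set X)}

/-- The increasing monotonicity property of a nice cover. -/
def UniqueParents (B : ℕ → Set (Set X)) : Prop :=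
  ∀ n, ∀ U ∈ B n, ∀ m < n, ∃! V, V ∈ B m ∧ U ⊆ V

/-- `V` is the ancestor at level `n` of the element `W` of level `n + t`. For `t = 0` this means
`V = W`, although distinct sets of the same level may be comparable. -/
def IsAncestor (B : ℕ → Set (Set X)) (n t : ℕ) (V W : Set X) : Prop :=
  V ∈ B n ∧ W ∈ B (n + t) ∧ W ⊆ V ∧ (t = 0 → V = W)

/-- `W` is an element of level `m` which can carry mass in a supergale: its parent, unless equal
to `W`, is not an element of level `m`. (If the parent `U` were an element of level `m`, then `U`
and `W` would both be children of `U`, which leaves no mass for `W`.) -/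
def CanCarry (B : ℕ → Set (Set X)) (m : ℕ) (W : Set X) : Prop :=
  W ∈ B m ∧ (m = 0 ∨ ∃ U, IsAncestor B (m - 1) 1 U W ∧ (U = W ∨ U ∉ B m))

/-- A mass placed on `W` is counted at `V`. The levels are existentially quantified, because the
weight of a set must not depend on the level at which the set is considered. -/
def Collects (B : ℕ → Set (Set X)) (W V : Set X) : Prop :=
  ∃ n t, IsAncestor B n t V W ∧ CanCarry B (n + t) W

theorem UniqueParents.eq (hB : UniqueParents B) {m n : ℕ} {U V V' : Set X} (hmn : m < n)
    (hU : U ∈ B n) (hV : V ∈ B m) (hV' : V' ∈ B m) (h : U ⊆ V) (h' : U ⊆ V') : V = V' :=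
  (hB n U hU m hmn).unique ⟨hV, h⟩ ⟨hV', h'⟩

/-- The set of levels of a set is an interval. -/
theorem UniqueParents.mem_of_between (hB : UniqueParents B) {i j k : ℕ} {V : Set X} (hi : V ∈ B i)
    (hk : V ∈ B k) (hij : i ≤ j) (hjk : j ≤ k) : V ∈ B j := by
  rcases hij.eq_or_lt with rfl | hij
  · exact hi
  rcases hjk.eq_or_lt with rfl | hjk
  · exact hk
  obtain ⟨Z, ⟨hZ, hVZ⟩, -⟩ := hB k V hk j hjk
  obtain ⟨P, ⟨hP, hZP⟩, -⟩ := hB j Z hZ i hij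
  have : V = P := hB.eq (hij.trans hjk) hk hi hP subset_rfl (hVZ.trans hZP)
  rwa [hVZ.antisymm (this ▸ hZP)]

theorem Collects.eq_or_exists (hB : UniqueParents B) {W V : Set X} (h : Collects B W V) {j : ℕ}
    (hj : V ∈ B j) : V = W ∨ ∃ m, j < m ∧ W ∈ B m ∧ W ⊆ V := by
  obtain ⟨n, t, ⟨hVn, hW, hWV, ht⟩, -, hc⟩ := h
  rcases lt_or_ge j (n + t) with hjm | hjm
  · exact Or.inr ⟨n + t, hjm, hW, hWV⟩
  rcases Nat.eq_zero_or_pos t with rfl | htpos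
  · exact Or.inl (ht rfl)
  left
  have hVm : V ∈ B (n + t) := hB.mem_of_between hVn hj (by omega) hjm
  have hVm' : V ∈ B (n + t - 1) := hB.mem_of_between hVn hVm (by omega) (by omega)
  rcases hc with hc | ⟨U, ⟨hU, -, hWU, -⟩, hc⟩
  · omega
  have hUV : U = V := hB.eq (m := n + t - 1) (n := n + t) (by omega) hW hU hVm' hWU hWV
  rcases hc with rfl | hc
  · exact hUV.symm
  · exact absurd (hUV ▸ hVm) hc

/-- A mass is counted at most once on each level. -/
theorem Collects.unique (hB : UniqueParents B) {W V V' : Set X} (h : Collects B W V)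
    (h' : Collects B W V') {j : ℕ} (hV : V ∈ B j) (hV' : V' ∈ B j) : V = V' := by
  rcases h.eq_or_exists hB hV with rfl | ⟨m, hm, hW, hWV⟩ <;>
    rcases h'.eq_or_exists hB hV' with rfl | ⟨m', hm', hW', hWV'⟩
  · rfl
  · exact hB.eq hm' hW' hV hV' subset_rfl hWV'
  · exact hB.eq hm hW hV hV' hWV subset_rfl
  · exact hB.eq hm hW hV hV' hWV (by assumption)

theorem Collects.parent (hB : UniqueParents B) {W V U : Set X} (h : Collects B W V) {n : ℕ}
    (hV : V ∈ B (n + 1)) (hU : U ∈ B n) (hVU : V ⊆ U) : Collects B W U := by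
  obtain ⟨k, t, ⟨hVk, hW, hWV, ht⟩, hc⟩ := h
  rcases lt_or_ge n (k + t) with hn | hn
  · refine ⟨n, k + t - n, ⟨hU, ?_, hWV.trans hVU, by omega⟩, ?_⟩ <;>
    rwa [Nat.add_sub_cancel' hn.le]
  · have hVn : V ∈ B n := hB.mem_of_between hVk hV (by omega) (Nat.le_succ n)
    rw [hB.eq (Nat.lt_succ_self n) hV hU hVn hVU subset_rfl]
    exact ⟨k, t, ⟨hVk, hW, hWV, ht⟩, hc⟩

theorem CanCarry.collects_self {m : ℕ} {W : Set X} (h : CanCarry B m W) : Collects B W W :=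
  ⟨m, 0, ⟨h.1, h.1, subset_rfl, fun _ => rfl⟩, h⟩

end Ancestors

/-! ### The supergale of a family of masses -/

section Mass

variable {X : Type*} {B : ℕ → Set (Set X)} {ι : Type*}

open Classical in
/-- The total weight of the indices `i` whose mass is counted at `U`. -/
noncomputable def mass (ω : ι → ℝ≥0∞) (Q : ι → Set X → Prop) (U : Set X) : ℝ≥0∞ :=
  ∑' i, if Q i U then ω i else 0

theorem mass_le (ω : ι → ℝ≥0∞) (Q : ι → Set X → Prop) (U : Set X) : mass ω Q U ≤ ∑' i, ω i :=
  ENNReal.tsum_le_tsum fun i => by split_ifs <;> simp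

theorem le_mass {ω : ι → ℝ≥0∞} {Q : ι → Set X → Prop} {U : Set X} {i : ι} (h : Q i U) :
    ω i ≤ mass ω Q U := by
  classical
  refine le_trans ?_ (ENNReal.le_tsum i)
  rw [if_pos h]

open Classical in
theorem tsum_ite_le_of_subsingleton {σ : Type*} {p : σ → Prop} {q : Prop} {c : ℝ≥0∞}
    (h : ∀ a b, p a → p b → a = b) (hq : ∀ a, p a → q) :
    ∑' a, (if p a then c else 0) ≤ if q then c else 0 := by
  by_cases hp : ∃ a, p a
  · obtain ⟨a, ha⟩ := hp
    rw [if_pos (hq a ha), tsum_eq_single a fun b hb => if_neg fun hpb => hb (h b a hpb ha), if_pos ha]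
  · rw [ENNReal.tsum_eq_zero.2 fun a => if_neg fun ha => hp ⟨a, ha⟩]
    exact zero_le

/-- The weights of the elements of a subset of a level add up to at most the weight of the indices
counted somewhere in this subset. -/
theorem tsum_mass_le (ω : ι → ℝ≥0∞) {Q : ι → Set X → Prop} {S : Set (Set X)} {R : ι → Prop}
    (h : ∀ i, ∀ V ∈ S, ∀ V' ∈ S, Q i V → Q i V' → V = V') (hR : ∀ i, ∀ V ∈ S, Q i V → R i)
    [DecidablePred R] :
    ∑' V : S, mass ω Q V ≤ ∑' i, if R i then ω i else 0 := by
  classical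
  unfold mass
  rw [ENNReal.tsum_comm]
  refine ENNReal.tsum_le_tsum fun i => ?_
  convert tsum_ite_le_of_subsingleton (p := fun V : S => Q i V) (q := R i) (c := ω i)
    (fun V V' hV hV' => Subtype.ext (h i V V.2 V' V'.2 hV hV')) (fun V hV => hR i V V.2 hV)

/-- The density of the weight function `mass ω Q` with respect to the `s`-th power of the
diameter. On sets of diameter `0` the quotient is `0` or `∞`, and the value is `0` in both cases. -/
noncomputable def massGale [MetricSpace X] (ω : ι → ℝ≥0∞) (Q : ι → Set X → Prop) (s : ℝ≥0)
    (U : Set X) : ℝ≥0 :=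
  (mass ω Q U / Metric.ediam U ^ (s : ℝ)).toNNReal

variable [MetricSpace X]

theorem massGale_mul_le (ω : ι → ℝ≥0∞) (Q : ι → Set X → Prop) {s : ℝ≥0} {U : Set X} (hs : 0 < s)
    (hU : Metric.ediam U ≠ ∞) :
    (massGale ω Q s U : ℝ≥0∞) * Metric.ediam U ^ (s : ℝ) ≤ mass ω Q U := by
  rcases eq_or_ne (Metric.ediam U) 0 with h0 | h0
  · rw [h0, ENNReal.zero_rpow_of_pos (by exact_mod_cast hs), mul_zero]
    exact zero_le
  · refine le_trans (mul_le_mul_left ENNReal.coe_toNNReal_le_self _) ?_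
    exact (ENNReal.div_mul_cancel (ENNReal.rpow_pos h0.bot_lt hU).ne'
      (ENNReal.rpow_ne_top_of_nonneg s.2 hU)).le

theorem coe_massGale {ω : ι → ℝ≥0∞} (hω : ∑' i, ω i ≠ ∞) (Q : ι → Set X → Prop) {s : ℝ≥0}
    {U : Set X} (h0 : Metric.ediam U ≠ 0) (hU : Metric.ediam U ≠ ∞) :
    (massGale ω Q s U : ℝ≥0∞) = mass ω Q U / Metric.ediam U ^ (s : ℝ) := by
  refine ENNReal.coe_toNNReal (ENNReal.div_ne_top ?_ ?_)
  · exact ((mass_le ω Q U).trans_lt hω.lt_top).ne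
  · exact (ENNReal.rpow_pos h0.bot_lt hU).ne'

/-- A family of masses of finite total weight, each of which is counted at most once on each level
and passed on to the parents, defines a supergale. -/
theorem isSupergale_massGale {ω : ι → ℝ≥0∞} (hω : ∑' i, ω i ≠ ∞) {Q : ι → Set X → Prop}
    {s : ℝ≥0} (hs : 0 < s) (hfin : ∀ n, ∀ U ∈ B n, Metric.ediam U ≠ ∞)
    (huniq : ∀ i n, ∀ V ∈ B n, ∀ V' ∈ B n, Q i V → Q i V' → V = V')
    (hpar : ∀ i n, ∀ U ∈ B n, ∀ V ∈ B (n + 1), V ⊆ U → Q i V → Q i U) :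
    IsSupergale B s (massGale ω Q s) where
  sum_zero := by
    classical
    refine lt_of_le_of_lt ?_ hω.lt_top
    calc ∑' U : {U // U ∈ B 0}, (massGale ω Q s U : ℝ≥0∞) * Metric.ediam (U : Set X) ^ (s : ℝ)
        ≤ ∑' U : B 0, mass ω Q U :=
          ENNReal.tsum_le_tsum fun U => massGale_mul_le ω Q hs (hfin 0 U U.2)
      _ ≤ ∑' i, if True then ω i else 0 :=
          tsum_mass_le ω (R := fun _ => True) (fun i => huniq i 0) fun _ _ _ _ => trivial
      _ = ∑' i, ω i := by simp
  sum_children := by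
    classical
    intro n U hU
    rcases eq_or_ne (Metric.ediam U) 0 with h0 | h0
    · refine le_of_eq_of_le (ENNReal.tsum_eq_zero.2 fun V => ?_) zero_le
      rw [le_antisymm ((Metric.ediam_mono V.2.2).trans h0.le) zero_le,
        ENNReal.zero_rpow_of_pos (by exact_mod_cast hs), mul_zero]
    · have hcancel : mass ω Q U / Metric.ediam U ^ (s : ℝ) * Metric.ediam U ^ (s : ℝ) =
          mass ω Q U := ENNReal.div_mul_cancel (ENNReal.rpow_pos h0.bot_lt (hfin n U hU)).ne'
        (ENNReal.rpow_ne_top_of_nonneg s.2 (hfin n U hU))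
      rw [coe_massGale hω Q h0 (hfin n U hU), hcancel]
      calc ∑' V : {V // V ∈ B (n + 1) ∧ V ⊆ U},
            (massGale ω Q s V : ℝ≥0∞) * Metric.ediam (V : Set X) ^ (s : ℝ)
          ≤ ∑' V : {V | V ∈ B (n + 1) ∧ V ⊆ U}, mass ω Q V :=
            ENNReal.tsum_le_tsum fun V => massGale_mul_le ω Q hs (hfin (n + 1) V V.2.1)
        _ ≤ ∑' i, if Q i U then ω i else 0 :=
            tsum_mass_le ω (fun i V hV V' hV' => huniq i (n + 1) V hV.1 V' hV'.1)
              fun i V hV => hpar i n U hU V hV.1 hV.2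
        _ = mass ω Q U := by unfold mass; rfl

end Mass

/-! ### The sets on which a supergale is large -/

section Large

variable {X : Type*} [MetricSpace X] {B : ℕ → Set (Set X)} {s : ℝ≥0} {d : Set X → ℝ≥0}

/-- The total weight of a supergale on any level is at most its weight on level `0`. -/
theorem IsSupergale.tsum_level_le (hB : UniqueParents B) (hd : IsSupergale B s d) (n : ℕ) :
    ∑' U : B n, (d U : ℝ≥0∞) * Metric.ediam (U : Set X) ^ (s : ℝ) ≤
      ∑' U : B 0, (d U : ℝ≥0∞) * Metric.ediam (U : Set X) ^ (s : ℝ) := by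
  induction n with
  | zero => exact le_rfl
  | succ n ih =>
    refine le_trans ?_ ih
    choose par hpar using fun V : B (n + 1) => (hB (n + 1) V V.2 n (Nat.lt_succ_self n)).exists
    let φ : B (n + 1) → Σ U : B n, {V // V ∈ B (n + 1) ∧ V ⊆ U} :=
      fun V => ⟨⟨par V, (hpar V).1⟩, ⟨V, V.2, (hpar V).2⟩⟩
    have hφ : Function.Injective φ := by
      intro V V' h
      have h2 := congrArg (fun z : Σ U : B n, {V // V ∈ B (n + 1) ∧ V ⊆ U} => (z.2 : Set X)) h
      exact Subtype.ext h2
    calc ∑' V : B (n + 1), (d V : ℝ≥0∞) * Metric.ediam (V : Set X) ^ (s : ℝ)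
        ≤ ∑' z : Σ U : B n, {V // V ∈ B (n + 1) ∧ V ⊆ U},
            (d z.2 : ℝ≥0∞) * Metric.ediam (z.2 : Set X) ^ (s : ℝ) :=
          ENNReal.tsum_comp_le_tsum_of_injective hφ
            fun z => (d z.2 : ℝ≥0∞) * Metric.ediam (z.2 : Set X) ^ (s : ℝ)
      _ = ∑' U : B n, ∑' V : {V // V ∈ B (n + 1) ∧ V ⊆ U},
            (d V : ℝ≥0∞) * Metric.ediam (V : Set X) ^ (s : ℝ) :=
          ENNReal.tsum_sigma fun (U : B n) (V : {V // V ∈ B (n + 1) ∧ V ⊆ (U : Set X)}) =>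
            (d V : ℝ≥0∞) * Metric.ediam (V : Set X) ^ (s : ℝ)
      _ ≤ ∑' U : B n, (d U : ℝ≥0∞) * Metric.ediam (U : Set X) ^ (s : ℝ) :=
          ENNReal.tsum_le_tsum fun U => hd.sum_children n U U.2

theorem IsSupergale.sum_le_mul (hB : UniqueParents B) (hd : IsSupergale B s d) (N : ℕ)
    (S : Finset (Set X)) (hS : ∀ U ∈ S, ∃ n < N, U ∈ B n) :
    ∑ U ∈ S, (d U : ℝ≥0∞) * Metric.ediam U ^ (s : ℝ) ≤
      N * ∑' U : B 0, (d U : ℝ≥0∞) * Metric.ediam (U : Set X) ^ (s : ℝ) := by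
  classical
  set F : Set X → ℝ≥0∞ := fun U => (d U : ℝ≥0∞) * Metric.ediam U ^ (s : ℝ) with hF
  have h1 : ∀ n, ∑ U ∈ S, (if U ∈ B n then F U else 0) ≤ ∑' U : B 0, F U := by
    intro n
    refine le_trans ?_ (hd.tsum_level_le hB n)
    rw [tsum_subtype (B n) F]
    refine le_trans (le_of_eq ?_) (ENNReal.sum_le_tsum S)
    exact Finset.sum_congr rfl fun U _ => by simp [Set.indicator_apply]
  calc ∑ U ∈ S, F U ≤ ∑ U ∈ S, ∑ n ∈ Finset.range N, (if U ∈ B n then F U else 0) := by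
        refine Finset.sum_le_sum fun U hU => ?_
        obtain ⟨n, hn, hUn⟩ := hS U hU
        have h2 : F U = if U ∈ B n then F U else 0 := (if_pos hUn).symm
        refine h2.trans_le ?_
        exact Finset.single_le_sum (f := fun n => if U ∈ B n then F U else 0)
          (fun _ _ => zero_le) (Finset.mem_range.2 hn)
    _ = ∑ n ∈ Finset.range N, ∑ U ∈ S, (if U ∈ B n then F U else 0) := Finset.sum_comm
    _ ≤ ∑ n ∈ Finset.range N, ∑' U : B 0, F U := Finset.sum_le_sum fun n _ => h1 n
    _ = N * ∑' U : B 0, F U := by simp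

/-- A set of positive weight can carry mass: if its parent `U` were an element of the same level,
then the weights of both would add up to at most the weight of `U`. -/
theorem IsSupergale.canCarry (hB : UniqueParents B) (hd : IsSupergale B s d) {m : ℕ} {W : Set X}
    (hfin : ∀ n, ∀ U ∈ B n, Metric.ediam U ≠ ∞)
    (hW : W ∈ B m) (hdW : d W ≠ 0) (hW0 : Metric.ediam W ≠ 0) : CanCarry B m W := by
  refine ⟨hW, ?_⟩
  rcases m with _ | n
  · exact Or.inl rfl
  right
  obtain ⟨U, ⟨hU, hWU⟩, -⟩ := hB (n + 1) W hW n (Nat.lt_succ_self n)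
  refine ⟨U, ⟨hU, hW, hWU, by simp⟩, ?_⟩
  by_contra! hc
  let F : Set X → ℝ≥0∞ := fun U => (d U : ℝ≥0∞) * Metric.ediam U ^ (s : ℝ)
  let a : {V // V ∈ B (n + 1) ∧ V ⊆ U} := ⟨U, hc.2, subset_rfl⟩
  let b : {V // V ∈ B (n + 1) ∧ V ⊆ U} := ⟨W, hW, hWU⟩
  have hab : a ≠ b := fun h => hc.1 (congrArg Subtype.val h)
  have h1 : F U + F W ≤ F U := by
    refine le_trans ?_ (hd.sum_children n U hU)
    classical
    refine le_trans (le_of_eq ?_) (ENNReal.sum_le_tsum {a, b})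
    rw [Finset.sum_pair hab]
  have hFU : F U ≠ ∞ := ENNReal.mul_ne_top ENNReal.coe_ne_top
    (ENNReal.rpow_ne_top_of_nonneg s.2 (hfin n U hU))
  have hFW : F W ≠ 0 := mul_ne_zero (by exact_mod_cast hdW)
    (ENNReal.rpow_pos hW0.bot_lt (hfin _ W hW)).ne'
  exact absurd h1 (not_le.2 (ENNReal.lt_add_right hFU hFW))

end Large

/-! ### Effectivity of the ancestor relation -/

section Effective

variable {κ : Type*}

/-- Starting from the name `u` of a set of level `n`, descend `t` levels, where the child chosen at
step `i` is the one at position `l[i]` in the list of children computed by `P`. -/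
def descend (P : ℕ × κ → List κ) (n : ℕ) (u : κ) (l : List ℕ) (t : ℕ) : Option κ :=
  t.rec (some u) fun i o => o.bind fun v => l[i]?.bind fun j => (P (n + i, v))[j]?

theorem descend_succ (P : ℕ × κ → List κ) (n : ℕ) (u : κ) (l : List ℕ) (t : ℕ) :
    descend P n u l (t + 1) =
      (descend P n u l t).bind fun v => l[t]?.bind fun j => (P (n + t, v))[j]? := rfl

theorem descend_append (P : ℕ × κ → List κ) (n : ℕ) (u : κ) (l l' : List ℕ) {t : ℕ}
    (ht : t ≤ l.length) : descend P n u (l ++ l') t = descend P n u l t := by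
  induction t with
  | zero => rfl
  | succ t ih =>
    rw [descend_succ, descend_succ, ih (by omega), List.getElem?_append_left (by omega)]

theorem computable_descend [Primcodable κ] {P : ℕ × κ → List κ} (hP : Computable P) :
    Computable fun x : (ℕ × κ) × List ℕ × ℕ => descend P x.1.1 x.1.2 x.2.1 x.2.2 := by
  refine Computable.nat_rec (f := fun x : (ℕ × κ) × List ℕ × ℕ => x.2.2)
    (g := fun x => some x.1.2)
    (h := fun x (y : ℕ × Option κ) => y.2.bind fun v =>
      x.2.1[y.1]?.bind fun j => (P (x.1.1 + y.1, v))[j]?)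
    (Computable.snd.comp Computable.snd)
    (Computable.option_some.comp (Computable.snd.comp Computable.fst)) ?_
  refine Computable.option_bind (Computable.snd.comp Computable.snd) ?_
  have cx : Computable fun z : (((ℕ × κ) × List ℕ × ℕ) × ℕ × Option κ) × κ => z.1.1 :=
    Computable.fst.comp Computable.fst
  have ci : Computable fun z : (((ℕ × κ) × List ℕ × ℕ) × ℕ × Option κ) × κ => z.1.2.1 :=
    Computable.fst.comp (Computable.snd.comp Computable.fst)
  refine Computable.option_bind (Computable.list_getElem?.comp
    (Computable.fst.comp (Computable.snd.comp cx)) ci) ?_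
  refine Computable.list_getElem?.comp (hP.comp (Computable.pair ?_ ?_)) Computable.snd
  · exact Primrec.nat_add.to_comp.comp
      ((Computable.fst.comp (Computable.fst.comp cx)).comp Computable.fst)
      (ci.comp Computable.fst)
  · exact Computable.snd.comp Computable.fst

end Effective

section Cover

variable {X : Type*} [MetricSpace X] (C : ComputableNiceCover X)

theorem ComputableNiceCover.uniqueParents : UniqueParents C.B :=
  C.isNiceCover.choose_spec.unique_parent

theorem ComputableNiceCover.exists_mem (w : List (Fin C.k)) : ∃ n, C.δ w ∈ C.B n := by
  have : C.δ w ∈ Set.range C.δ := ⟨w, rfl⟩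
  rw [C.range_δ] at this
  exact Set.mem_iUnion.1 this

theorem ComputableNiceCover.exists_name {n : ℕ} {U : Set X} (h : U ∈ C.B n) :
    ∃ w, C.δ w = U := by
  have : U ∈ Set.range C.δ := by
    rw [C.range_δ]
    exact Set.mem_iUnion.2 ⟨n, h⟩
  exact this

theorem ComputableNiceCover.ediam_ne_top (n : ℕ) (U : Set X) (h : U ∈ C.B n) :
    Metric.ediam U ≠ ∞ := by
  obtain ⟨ζ, -, -, hs⟩ := C.small_size
  exact (hs n U h).ne_top

/-- Every ancestor is connected to its descendant by a chain of children, because the members of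
the chain of parents are unique. This makes inclusion computably enumerable. -/
theorem exists_descend_iff {P : ℕ × List (Fin C.k) → List (List (Fin C.k))}
    (hP : ∀ n w, C.δ w ∈ C.B n →
      {V | ∃ v ∈ P (n, w), C.δ v = V} = {V | V ∈ C.B (n + 1) ∧ V ⊆ C.δ w})
    {n : ℕ} {u : List (Fin C.k)} (hu : C.δ u ∈ C.B n) (t : ℕ) (W : Set X) :
    IsAncestor C.B n t (C.δ u) W ↔
      ∃ l : List ℕ, l.length = t ∧ ∃ v, descend P n u l t = some v ∧ C.δ v = W := by
  have hB := C.uniqueParents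
  induction t generalizing W with
  | zero =>
    constructor
    · rintro ⟨-, -, -, h⟩
      exact ⟨[], rfl, u, rfl, h rfl⟩
    · rintro ⟨l, -, v, hv, rfl⟩
      obtain rfl : u = v := Option.some.inj hv
      exact ⟨hu, hu, subset_rfl, fun _ => rfl⟩
  | succ t ih =>
    constructor
    · rintro ⟨-, hW, hWu, -⟩
      obtain ⟨V, ⟨hV, hWV⟩, -⟩ := hB (n + (t + 1)) W hW (n + t) (by omega)
      have hVu : IsAncestor C.B n t (C.δ u) V := by
        refine ⟨hu, hV, ?_, ?_⟩
        · rcases Nat.eq_zero_or_pos t with rfl | ht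
          · exact (hB.eq (by omega) hW hV hu hWV hWu).subset
          · obtain ⟨Z, ⟨hZ, hVZ⟩, -⟩ := hB (n + t) V hV n (by omega)
            rwa [← hB.eq (by omega) hW hZ hu (hWV.trans hVZ) hWu]
        · rintro rfl
          exact hB.eq (by omega) hW hu hV hWu hWV
      obtain ⟨l, hl, v, hv, rfl⟩ := (ih V).1 hVu
      have hWP : W ∈ {V | ∃ w ∈ P (n + t, v), C.δ w = V} := by
        rw [hP _ _ hV]; exact ⟨hW, hWV⟩
      obtain ⟨w, hw, rfl⟩ := hWP
      obtain ⟨j, hj⟩ := List.mem_iff_getElem?.1 hw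
      refine ⟨l ++ [j], by simp [hl], w, ?_, rfl⟩
      rw [descend_succ, descend_append _ _ _ _ _ hl.ge, hv]
      simp [← hl] at hj ⊢
      exact hj
    · rintro ⟨l, hl, w, hw, rfl⟩
      have hlt : l.take t ++ l.drop t = l := List.take_append_drop t l
      rw [descend_succ, Option.bind_eq_some_iff] at hw
      obtain ⟨v, hv, hw⟩ := hw
      obtain ⟨j, -, hw⟩ := Option.bind_eq_some_iff.1 hw
      rw [← hlt, descend_append _ _ _ _ _ (by simp [hl])] at hv
      obtain ⟨-, hV, hVu, -⟩ := (ih (C.δ v)).2 ⟨l.take t, by simp [hl], v, hv, rfl⟩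
      have hw' : C.δ w ∈ {V | ∃ w ∈ P (n + t, v), C.δ w = V} :=
        ⟨w, List.mem_iff_getElem?.2 ⟨j, hw⟩, rfl⟩
      rw [hP _ _ hV] at hw'
      exact ⟨hu, hw'.1, hw'.2.trans hVu, by simp⟩

theorem rePred_isAncestor : REPred fun x : (ℕ × ℕ) × List (Fin C.k) × List (Fin C.k) =>
    IsAncestor C.B x.1.1 x.1.2 (C.δ x.2.1) (C.δ x.2.2) := by
  obtain ⟨P, cP, hP⟩ := C.computable_children
  let α := (ℕ × ℕ) × List (Fin C.k) × List (Fin C.k)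
  have cn : Computable fun x : α => x.1.1 := Computable.fst.comp Computable.fst
  have ct : Computable fun x : α => x.1.2 := Computable.snd.comp Computable.fst
  have cu : Computable fun x : α => x.2.1 := Computable.fst.comp Computable.snd
  have cw : Computable fun x : α => x.2.2 := Computable.snd.comp Computable.snd
  have h1 : REPred fun x : α => C.δ x.2.1 ∈ C.B x.1.1 :=
    (C.decidable_level.comp (cn.pair cu)).to_re
  have h2 : REPred fun y : (α × List ℕ) × List (Fin C.k) =>
      y.1.2.length = y.1.1.1.2 ∧ descend P y.1.1.1.1 y.1.1.2.1 y.1.2 y.1.1.1.2 = some y.2 ∧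
        C.δ y.2 = C.δ y.1.1.2.2 := by
    have cx : Computable fun y : (α × List ℕ) × List (Fin C.k) => y.1.1 :=
      Computable.fst.comp Computable.fst
    have cl : Computable fun y : (α × List ℕ) × List (Fin C.k) => y.1.2 :=
      Computable.snd.comp Computable.fst
    refine REPred.and ?_ (REPred.and ?_ ?_)
    · exact ((PrimrecPred.computablePred (p := fun z : ℕ × ℕ => z.1 = z.2) Primrec.eq).comp
        ((Computable.list_length.comp cl).pair (ct.comp cx))).to_re
    · exact ((PrimrecPred.computablePred
        (p := fun z : Option (List (Fin C.k)) × Option (List (Fin C.k)) => z.1 = z.2)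
        Primrec.eq).comp (((computable_descend cP).comp
          (((cn.comp cx).pair (cu.comp cx)).pair (cl.pair (ct.comp cx)))).pair
            (Computable.option_some.comp Computable.snd))).to_re
    · exact (C.decidable_eq.comp (Computable.snd.pair (cw.comp cx))).to_re
  refine (h1.and h2.exists.exists).of_eq fun x => ?_
  constructor
  · rintro ⟨hu, l, v, hl, hv, hw⟩
    exact (exists_descend_iff C hP hu _ _).2 ⟨l, hl, v, hv, hw⟩
  · intro h
    obtain ⟨l, hl, v, hv, hw⟩ := (exists_descend_iff C hP h.1 _ _).1 h
    exact ⟨h.1, l, v, hl, hv, hw⟩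

theorem rePred_canCarry : REPred fun x : ℕ × List (Fin C.k) => CanCarry C.B x.1 (C.δ x.2) := by
  have h1 : REPred fun x : ℕ × List (Fin C.k) => C.δ x.2 ∈ C.B x.1 := C.decidable_level.to_re
  have h2 : REPred fun x : ℕ × List (Fin C.k) => x.1 = 0 :=
    ((PrimrecPred.computablePred (p := fun z : ℕ × ℕ => z.1 = z.2) Primrec.eq).comp
      (Computable.fst.pair (Computable.const 0))).to_re
  have h3 : REPred fun y : (ℕ × List (Fin C.k)) × List (Fin C.k) =>
      IsAncestor C.B (y.1.1 - 1) 1 (C.δ y.2) (C.δ y.1.2) ∧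
        (C.δ y.2 = C.δ y.1.2 ∨ C.δ y.2 ∉ C.B y.1.1) := by
    have cn : Computable fun y : (ℕ × List (Fin C.k)) × List (Fin C.k) => y.1.1 :=
      Computable.fst.comp Computable.fst
    have cw : Computable fun y : (ℕ × List (Fin C.k)) × List (Fin C.k) => y.1.2 :=
      Computable.snd.comp Computable.fst
    refine REPred.and ?_ (REPred.or ?_ ?_)
    · exact (rePred_isAncestor C).comp (((Computable.pred.comp cn).pair (Computable.const 1)).pair
        (Computable.snd.pair cw))
    · exact (C.decidable_eq.comp (Computable.snd.pair cw)).to_re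
    · exact (C.decidable_level.not.comp (cn.pair Computable.snd)).to_re
  refine (h1.and (h2.or h3.exists)).of_eq fun x => and_congr_right fun _ => or_congr_right ?_
  constructor
  · rintro ⟨u, hu⟩
    exact ⟨_, hu⟩
  · rintro ⟨U, hU⟩
    obtain ⟨u, rfl⟩ := C.exists_name hU.1.1
    exact ⟨u, hU⟩

theorem rePred_collects : REPred fun x : List (Fin C.k) × List (Fin C.k) =>
    Collects C.B (C.δ x.1) (C.δ x.2) := by
  have cn : Computable fun y : ((List (Fin C.k) × List (Fin C.k)) × ℕ) × ℕ => y.1.2 :=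
    Computable.snd.comp Computable.fst
  have cw : Computable fun y : ((List (Fin C.k) × List (Fin C.k)) × ℕ) × ℕ => y.1.1.1 :=
    Computable.fst.comp (Computable.fst.comp Computable.fst)
  have cv : Computable fun y : ((List (Fin C.k) × List (Fin C.k)) × ℕ) × ℕ => y.1.1.2 :=
    Computable.snd.comp (Computable.fst.comp Computable.fst)
  have h1 := REPred.comp (p := fun x : (ℕ × ℕ) × List (Fin C.k) × List (Fin C.k) =>
    IsAncestor C.B x.1.1 x.1.2 (C.δ x.2.1) (C.δ x.2.2)) (rePred_isAncestor C)
    ((cn.pair Computable.snd).pair (cv.pair cw))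
  have h2 := REPred.comp (p := fun x : ℕ × List (Fin C.k) => CanCarry C.B x.1 (C.δ x.2))
    (rePred_canCarry C) ((Primrec.nat_add.to_comp.comp cn Computable.snd).pair cw)
  exact (h1.and h2).exists.exists

end Cover

/-! ### A universal constructive supergale -/

section Universal

variable {X : Type*} [MetricSpace X] (C : ComputableNiceCover X)

/-- An index `n` encodes a triple `(e, k, i)`: the run of the program `e` on the input `(k, i)`. It
carries the weight `2 ^ (-(e + 1) - (p + 1) * k)` if `i < 2 ^ (p * k)` and none otherwise. -/
noncomputable def univWeight (p n : ℕ) : ℝ≥0∞ :=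
  if n.unpair.2.unpair.2 < 2 ^ (p * n.unpair.2.unpair.1) then
    2⁻¹ ^ (n.unpair.1 + 1 + (p + 1) * n.unpair.2.unpair.1) else 0

/-- The run encoded by `n` outputs a name of a set whose mass is counted at `U`. -/
def UnivCollects (n : ℕ) (U : Set X) : Prop :=
  ∃ w : List (Fin C.k), Encodable.encode w ∈
    (Denumerable.ofNat Nat.Partrec.Code n.unpair.1).eval n.unpair.2 ∧ Collects C.B (C.δ w) U

/-- The supergale obtained by running all programs. -/
noncomputable def univGale (p : ℕ) (s : ℝ≥0) : Set X → ℝ≥0 :=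
  massGale (univWeight p) (UnivCollects C) s

theorem tsum_univWeight_ne_top (p : ℕ) : ∑' n, univWeight p n ≠ ∞ := by
  have h1 : ∑' n, univWeight p n = ∑' (e : ℕ) (k : ℕ) (i : ℕ),
      if i < 2 ^ (p * k) then (2⁻¹ : ℝ≥0∞) ^ (e + 1 + (p + 1) * k) else 0 := by
    let f : ℕ × ℕ × ℕ → ℝ≥0∞ := fun x =>
      if x.2.2 < 2 ^ (p * x.2.1) then (2⁻¹ : ℝ≥0∞) ^ (x.1 + 1 + (p + 1) * x.2.1) else 0
    calc ∑' n, univWeight p n = ∑' n : ℕ, f (n.unpair.1, n.unpair.2.unpair) := rfl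
      _ = ∑' y : ℕ × ℕ, f (y.1, y.2.unpair) :=
          Nat.pairEquiv.symm.tsum_eq fun y : ℕ × ℕ => f (y.1, y.2.unpair)
      _ = ∑' (e : ℕ) (m : ℕ), f (e, m.unpair) :=
          ENNReal.tsum_prod (f := fun e m : ℕ => f (e, m.unpair))
      _ = ∑' (e : ℕ) (y : ℕ × ℕ), f (e, y) :=
          tsum_congr fun e => Nat.pairEquiv.symm.tsum_eq fun y : ℕ × ℕ => f (e, y)
      _ = _ := tsum_congr fun e => ENNReal.tsum_prod (f := fun k i : ℕ => f (e, k, i))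
  have h2 : ∀ e k : ℕ, ∑' i : ℕ,
      (if i < 2 ^ (p * k) then (2⁻¹ : ℝ≥0∞) ^ (e + 1 + (p + 1) * k) else 0) =
        2⁻¹ ^ (e + 1) * 2⁻¹ ^ k := by
    intro e k
    rw [tsum_eq_sum (s := Finset.range (2 ^ (p * k))) fun i hi => if_neg (by simpa using hi),
      Finset.sum_congr rfl fun i hi => if_pos (Finset.mem_range.1 hi), Finset.sum_const,
      Finset.card_range, nsmul_eq_mul, Nat.cast_pow, Nat.cast_ofNat,
      show e + 1 + (p + 1) * k = p * k + (e + 1) + k by ring, pow_add, pow_add, ← mul_assoc,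
      ← mul_assoc, ← mul_pow, ENNReal.mul_inv_cancel (by simp) (by simp), one_pow, one_mul]
  have h3 : (∑' k : ℕ, (2⁻¹ : ℝ≥0∞) ^ k) = 2 := by
    rw [ENNReal.tsum_geometric, ENNReal.one_sub_inv_two, inv_inv]
  simp_rw [h1, h2, ENNReal.tsum_mul_left, h3, pow_succ, ENNReal.tsum_mul_right, h3]
  exact ENNReal.mul_ne_top (ENNReal.mul_ne_top (by simp) (by simp)) (by simp)

theorem isSupergale_univGale (p : ℕ) {s : ℝ≥0} (hs : 0 < s) :
    IsSupergale C.B s (univGale C p s) := by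
  have hB := C.uniqueParents
  refine isSupergale_massGale (tsum_univWeight_ne_top p) hs C.ediam_ne_top ?_ ?_
  · rintro i n V hV V' hV' ⟨w, hw, hwV⟩ ⟨w', hw', hwV'⟩
    obtain rfl : w = w' := Encodable.encode_injective (Part.mem_unique hw hw')
    exact hwV.unique hB hwV' hV hV'
  · rintro i n U hU V hV hVU ⟨w, hw, hwV⟩
    exact ⟨w, hw, hwV.parent hB hV hU hVU⟩

theorem rePred_univCollects : REPred fun x : List (Fin C.k) × ℕ =>
    UnivCollects C x.2 (C.δ x.1) := by
  have h1 : REPred fun y : (((List (Fin C.k) × ℕ) × List (Fin C.k)) × ℕ) =>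
      Encodable.encode y.1.2 ∈ (Denumerable.ofNat Nat.Partrec.Code y.1.1.2.unpair.1).evaln y.2
        y.1.1.2.unpair.2 := by
    have cn : Primrec fun y : (((List (Fin C.k) × ℕ) × List (Fin C.k)) × ℕ) => y.1.1.2.unpair :=
      Primrec.unpair.comp (Primrec.snd.comp (Primrec.fst.comp Primrec.fst))
    have ce := Nat.Partrec.Code.primrec_evaln.comp
      ((Primrec.snd.pair ((Primrec.ofNat Nat.Partrec.Code).comp (Primrec.fst.comp cn))).pair
        (Primrec.snd.comp cn))
    have cw : Primrec fun y : (((List (Fin C.k) × ℕ) × List (Fin C.k)) × ℕ) =>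
        some (Encodable.encode y.1.2) :=
      Primrec.option_some.comp (Primrec.encode.comp (Primrec.snd.comp Primrec.fst))
    exact (PrimrecPred.computablePred (Primrec.eq.comp ce cw)).to_re
  have h2 := REPred.comp (p := fun x : List (Fin C.k) × List (Fin C.k) =>
    Collects C.B (C.δ x.1) (C.δ x.2)) (rePred_collects C)
    (f := fun y : ((List (Fin C.k) × ℕ) × List (Fin C.k)) => (y.2, y.1.1))
    (Computable.snd.pair (Computable.fst.comp Computable.fst))
  refine (h1.exists.and h2).exists.of_eq fun x => exists_congr fun w => and_congr_left fun _ => ?_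
  exact (Nat.Partrec.Code.evaln_complete (c := Denumerable.ofNat Nat.Partrec.Code x.2.unpair.1)
    (n := x.2.unpair.2) (x := Encodable.encode w)).symm

theorem lowerSemicomputable_univGale (p : ℕ) (a b : ℕ) (ha : a ≠ 0) (hb : b ≠ 0) {s : ℝ≥0}
    (hs : (s : ℝ) = a / b) : LowerSemicomputable fun w => univGale C p s (C.δ w) := by
  classical
  have hs0 : (s : ℝ) ≠ 0 := by
    rw [hs]
    exact div_ne_zero (Nat.cast_ne_zero.2 ha) (Nat.cast_ne_zero.2 hb)
  let g : ℕ → ℕ := fun n => n.unpair.1 + 1 + (p + 1) * n.unpair.2.unpair.1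
  let r : List (Fin C.k) × ℕ → Prop := fun x =>
    x.2.unpair.2.unpair.2 < 2 ^ (p * x.2.unpair.2.unpair.1) ∧ UnivCollects C x.2 (C.δ x.1)
  have mul : Computable₂ fun a b : ℕ => a * b := Primrec.nat_mul.to_comp
  have cu2 : Computable fun n : ℕ => n.unpair.2.unpair :=
    Computable.unpair.comp (Computable.snd.comp Computable.unpair)
  have hg : Computable g := Primrec.nat_add.to_comp.comp
    (Computable.succ.comp (Computable.fst.comp Computable.unpair))
    (mul.comp (Computable.const (p + 1)) (Computable.fst.comp cu2))
  have hr : REPred r := by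
    refine REPred.and ?_ (rePred_univCollects C)
    exact rePred_lt (Computable.snd.comp (cu2.comp Computable.snd)) (computable_pow.comp
      (Computable.const 2) (mul.comp (Computable.const p)
        (Computable.fst.comp (cu2.comp Computable.snd))))
  have hterm : ∀ w n, (if UnivCollects C n (C.δ w) then univWeight p n else 0) =
      if r (w, n) then (2⁻¹ : ℝ≥0∞) ^ g n else 0 := by
    intro w n
    by_cases h1 : UnivCollects C n (C.δ w) <;>
      by_cases h2 : n.unpair.2.unpair.2 < 2 ^ (p * n.unpair.2.unpair.1) <;>
      simp [r, g, univWeight, h1, h2]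
  have hmass : ∀ w, mass (univWeight p) (UnivCollects C) (C.δ w) =
      ∑' n, if r (w, n) then (2⁻¹ : ℝ≥0∞) ^ g n else 0 := by
    intro w
    unfold mass
    refine tsum_congr fun n => ?_
    convert hterm w n
  have hreal : ∀ w n, (if r (w, n) then (2⁻¹ : ℝ≥0∞) ^ g n else 0).toReal =
      if r (w, n) then ((1 : ℝ) / 2) ^ g n else 0 := by
    intro w n
    split_ifs <;> simp
  have hne : ∀ w, ∑' n, (if r (w, n) then (2⁻¹ : ℝ≥0∞) ^ g n else 0) ≠ ∞ := by
    intro w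
    rw [← hmass]
    exact ((mass_le _ _ _).trans_lt (tsum_univWeight_ne_top p).lt_top).ne
  have hsum : ∀ w, Summable fun n => if r (w, n) then ((1 : ℝ) / 2) ^ g n else 0 := by
    intro w
    simpa only [hreal] using ENNReal.summable_toReal (hne w)
  have hmr : ∀ w, (mass (univWeight p) (UnivCollects C) (C.δ w)).toReal =
      ∑' n, if r (w, n) then ((1 : ℝ) / 2) ^ g n else 0 := by
    intro w
    rw [hmass, ENNReal.tsum_toReal_eq fun n => ENNReal.ne_top_of_tsum_ne_top (hne w) n]
    simp only [hreal]
  obtain ⟨N, hN, hle, hlim⟩ := exists_dyadic_approx hr hg hsum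
  refine (rePred_lt_div_rpow hN hle hlim C.computable_diam a b hb).of_eq fun ⟨w, q, m⟩ => ?_
  have hval : ((univGale C p s (C.δ w) : ℝ≥0) : ℝ) =
      (∑' n, if r (w, n) then ((1 : ℝ) / 2) ^ g n else 0) /
        (Metric.ediam (C.δ w)).toReal ^ ((a : ℝ) / b) := by
    rw [← hmr, ← hs, ENNReal.toReal_rpow, ← ENNReal.toReal_div]
    rfl
  simp only
  rw [hval]
  -- on sets of diameter `0` the value is `0`, which exceeds no nonnegative rational
  refine and_iff_right_of_imp fun h => ?_
  by_contra h0
  rw [le_antisymm (not_lt.1 h0) ENNReal.toReal_nonneg, ← hs, Real.zero_rpow hs0, div_zero] at h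
  exact absurd h (not_lt.2 (by positivity))

end Universal

/-! ### Domination of the constructive supergales of smaller exponent -/

section Domination

theorem rePred_pow_half_lt {α : Type*} [Primcodable α] {g : α → ℝ} (hg : ComputableReal g) :
    REPred fun x : ℕ × α => ((1 : ℝ) / 2) ^ x.1 < g x.2 := by
  obtain ⟨a, ca, ha⟩ := hg
  have mul : Computable₂ fun a b : ℕ => a * b := Primrec.nat_mul.to_comp
  have ca' : Computable fun y : (ℕ × α) × ℕ => a (y.1.2, y.2) :=
    ca.comp ((Computable.snd.comp Computable.fst).pair Computable.snd)
  have cj : Computable fun y : (ℕ × α) × ℕ => 2 ^ y.1.1 :=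
    computable_pow.comp (Computable.const 2) (Computable.fst.comp Computable.fst)
  have cT : Computable fun y : (ℕ × α) × ℕ => 2 ^ y.2 :=
    computable_pow.comp (Computable.const 2) Computable.snd
  have h : REPred fun y : (ℕ × α) × ℕ => 2 ^ y.2 + 2 ^ y.1.1 < a (y.1.2, y.2) * 2 ^ y.1.1 :=
    rePred_lt (Primrec.nat_add.to_comp.comp cT cj) (mul.comp ca' cj)
  have key : ∀ (j T n : ℕ), 2 ^ T + 2 ^ j < n * 2 ^ j ↔
      ((1 : ℝ) / 2) ^ j + 1 / 2 ^ T < (n : ℝ) / 2 ^ T := by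
    intro j T n
    rw [← Nat.cast_lt (α := ℝ), one_div_pow, div_add_div _ _ (by positivity) (by positivity),
      div_lt_div_iff₀ (by positivity) (by positivity),
      ← mul_lt_mul_iff_left₀ (show (0 : ℝ) < 2 ^ T by positivity)]
    push_cast
    rw [one_mul, mul_one, show (n : ℝ) * 2 ^ j * 2 ^ T = n * (2 ^ j * 2 ^ T) by ring]
  refine h.exists.of_eq fun ⟨j, w⟩ => ?_
  simp only [key]
  constructor
  · rintro ⟨T, hT⟩
    have := (abs_le.1 (ha w T)).2
    linarith
  · intro hlt
    obtain ⟨T, hT⟩ := exists_pow_lt_of_lt_one (half_pos (sub_pos.2 hlt))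
      (show (1 : ℝ) / 2 < 1 by norm_num)
    refine ⟨T, ?_⟩
    have := (abs_le.1 (ha w T)).1
    rw [one_div_pow] at hT
    linarith

variable {X : Type*} [MetricSpace X] (C : ComputableNiceCover X)

/-- Up to factors `2 ^ k`, a supergale of exponent `t` exceeds a constant on at most
`2 ^ (t * q * k)` sets of diameter greater than `2 ^ (-q * k)`. -/
theorem exists_card_le {t : ℝ≥0} {d : Set X → ℝ≥0} (hd : IsSupergale C.B t d) {q p : ℕ}
    (hpq : (q : ℝ) * t + 1 ≤ p) :
    ∃ K : ℕ, ∀ k, ∀ S : Finset (Set X),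
      (∀ U ∈ S, (∃ n, U ∈ C.B n) ∧ (K : ℝ) < d U ∧
        ((1 : ℝ) / 2) ^ (q * k) < (Metric.ediam U).toReal) → S.card ≤ 2 ^ (p * k) := by
  obtain ⟨ζ, hζ0, hζ1, hζ⟩ := C.small_size
  -- a set of diameter greater than `2 ^ (-q * k)` belongs only to levels below `L * k`
  obtain ⟨L, hL⟩ := exists_pow_lt_of_lt_one (show (0 : ℝ) < (1 / 2) ^ q by positivity) hζ1
  set c := ∑' U : C.B 0, (d U : ℝ≥0∞) * Metric.ediam (U : Set X) ^ (t : ℝ) with hc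
  have hc_top : c ≠ ∞ := hd.sum_zero.ne
  obtain ⟨K, hK⟩ := exists_nat_gt (L * c.toReal)
  have hK0 : (0 : ℝ) < K := lt_of_le_of_lt (by positivity) hK
  refine ⟨K, fun k S hS => ?_⟩
  have hlev : ∀ U ∈ S, ∃ n < L * k, U ∈ C.B n := by
    intro U hU
    obtain ⟨⟨n, hn⟩, -, h⟩ := hS U hU
    refine ⟨n, ?_, hn⟩
    by_contra! hnk
    have h1 : (Metric.ediam U).toReal < ζ ^ n :=
      (ENNReal.lt_ofReal_iff_toReal_lt (C.ediam_ne_top n U hn)).1 (hζ n U hn)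
    have h2 : ζ ^ n ≤ (1 / 2) ^ (q * k) := by
      calc ζ ^ n ≤ ζ ^ (L * k) := pow_le_pow_of_le_one hζ0.le hζ1.le hnk
        _ ≤ (1 / 2) ^ (q * k) := by
          rw [pow_mul, pow_mul]
          exact pow_le_pow_left₀ (by positivity) hL.le k
    linarith
  have hfin : ∀ U ∈ S, (d U : ℝ≥0∞) * Metric.ediam U ^ (t : ℝ) ≠ ∞ := by
    intro U hU
    obtain ⟨n, -, hn⟩ := hlev U hU
    exact ENNReal.mul_ne_top ENNReal.coe_ne_top
      (ENNReal.rpow_ne_top_of_nonneg t.2 (C.ediam_ne_top n U hn))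
  have h1 := ENNReal.toReal_mono (ENNReal.mul_ne_top (ENNReal.natCast_ne_top _) hc_top)
    (hd.sum_le_mul C.uniqueParents (L * k) S hlev)
  rw [ENNReal.toReal_sum hfin, ENNReal.toReal_mul, ENNReal.toReal_natCast] at h1
  have h2 : (S.card : ℝ) * (K * (((1 : ℝ) / 2) ^ (q * k)) ^ (t : ℝ)) ≤
      ∑ U ∈ S, ((d U : ℝ≥0∞) * Metric.ediam U ^ (t : ℝ)).toReal := by
    rw [← nsmul_eq_mul]
    refine Finset.card_nsmul_le_sum _ _ _ fun U hU => ?_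
    obtain ⟨-, h3, h4⟩ := hS U hU
    rw [ENNReal.toReal_mul, ENNReal.coe_toReal, ← ENNReal.toReal_rpow]
    exact mul_le_mul h3.le (Real.rpow_le_rpow (by positivity) h4.le t.2) (by positivity) (by simp)
  have h3 : (S.card : ℝ) * (((1 : ℝ) / 2) ^ (q * k)) ^ (t : ℝ) ≤ k := by
    refine le_of_mul_le_mul_left ?_ hK0
    calc (K : ℝ) * (S.card * (((1 : ℝ) / 2) ^ (q * k)) ^ (t : ℝ))
        = S.card * (K * (((1 : ℝ) / 2) ^ (q * k)) ^ (t : ℝ)) := by ring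
      _ ≤ ((L * k : ℕ) : ℝ) * c.toReal := h2.trans h1
      _ = (L * c.toReal) * k := by push_cast; ring
      _ ≤ K * k := by gcongr
  have h4 : (((1 : ℝ) / 2) ^ (q * k)) ^ (t : ℝ) = (2 ^ ((q : ℝ) * t * k))⁻¹ := by
    rw [one_div, inv_pow, Real.inv_rpow (by positivity), ← Real.rpow_natCast,
      ← Real.rpow_mul (by norm_num)]
    push_cast
    ring_nf
  rw [h4, ← div_eq_mul_inv, div_le_iff₀ (by positivity)] at h3
  have h5 : (S.card : ℝ) ≤ 2 ^ ((p : ℝ) * k) := by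
    calc (S.card : ℝ) ≤ k * 2 ^ ((q : ℝ) * t * k) := h3
      _ ≤ 2 ^ (k : ℝ) * 2 ^ ((q : ℝ) * t * k) := by
        gcongr
        rw [Real.rpow_natCast]
        exact_mod_cast Nat.lt_two_pow_self.le
      _ = 2 ^ (((q : ℝ) * t + 1) * k) := by
        rw [← Real.rpow_add (by norm_num)]
        ring_nf
      _ ≤ 2 ^ ((p : ℝ) * k) := by
        gcongr
        norm_num
  have h6 : (2 : ℝ) ^ ((p : ℝ) * k) = ((2 ^ (p * k) : ℕ) : ℝ) := by
    rw [← Nat.cast_mul, Real.rpow_natCast]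
    push_cast
    rfl
  rw [h6] at h5
  exact_mod_cast h5

theorem rePred_large {d : Set X → ℝ≥0} (hdc : LowerSemicomputable fun w => d (C.δ w)) (K q : ℕ) :
    REPred fun x : ℕ × List (Fin C.k) =>
      (K : ℝ) < d (C.δ x.2) ∧ ((1 : ℝ) / 2) ^ (q * x.1) < (Metric.ediam (C.δ x.2)).toReal := by
  have h1 := REPred.comp (p := fun x : List (Fin C.k) × ℕ × ℕ =>
    (x.2.1 : ℝ) / (x.2.2 + 1) < d (C.δ x.1)) hdc
    (f := fun x : ℕ × List (Fin C.k) => (x.2, K, 0)) (Computable.snd.pair (Computable.const _))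
  have h2 := REPred.comp (p := fun x : ℕ × List (Fin C.k) =>
    ((1 : ℝ) / 2) ^ x.1 < (Metric.ediam (C.δ x.2)).toReal) (rePred_pow_half_lt C.computable_diam)
    (f := fun x : ℕ × List (Fin C.k) => (q * x.1, x.2))
    ((Primrec.nat_mul.to_comp.comp (Computable.const q) Computable.fst).pair Computable.snd)
  exact (h1.and h2).of_eq fun x => by simp

theorem pow_half_mul_rpow_le {q p k : ℕ} (hq : q ≠ 0) (hk : k ≠ 0) {D : ℝ} (hD0 : 0 ≤ D)
    (hD : D ≤ (1 / 2) ^ (q * (k - 1))) :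
    ((1 : ℝ) / 2) ^ (p + 1) * D ^ (((p : ℝ) + 1) / q) ≤ (1 / 2) ^ ((p + 1) * k) := by
  have h4 : D ^ (((p : ℝ) + 1) / q) ≤ (1 / 2) ^ ((p + 1) * (k - 1)) := by
    calc D ^ (((p : ℝ) + 1) / q)
        ≤ (((1 : ℝ) / 2) ^ (q * (k - 1))) ^ (((p : ℝ) + 1) / q) :=
          Real.rpow_le_rpow hD0 hD (by positivity)
      _ = (1 / 2) ^ ((p + 1) * (k - 1)) := by
        rw [← Real.rpow_natCast, ← Real.rpow_mul (by norm_num), ← Real.rpow_natCast]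
        congr 1
        push_cast
        have : (q : ℝ) ≠ 0 := by exact_mod_cast hq
        field_simp
  calc ((1 : ℝ) / 2) ^ (p + 1) * D ^ (((p : ℝ) + 1) / q)
      ≤ (1 / 2) ^ (p + 1) * (1 / 2) ^ ((p + 1) * (k - 1)) := by gcongr
    _ = (1 / 2) ^ ((p + 1) * k) := by
      rw [← pow_add]
      congr 1
      obtain ⟨j, rfl⟩ := Nat.exists_eq_succ_of_ne_zero hk
      simp
      ring

/-- Where a constructive supergale of exponent `t` exceeds a constant, the universal supergale is at
least a constant times a negative power of the diameter. -/
theorem exists_le_univGale {t : ℝ≥0} {d : Set X → ℝ≥0} (hd : IsSupergale C.B t d)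
    (hdc : LowerSemicomputable fun w => d (C.δ w)) {q p : ℕ} (hq : q ≠ 0)
    (hpq : (q : ℝ) * t + 1 ≤ p) (s : ℝ≥0) :
    ∃ c : ℝ, 0 < c ∧ ∃ K : ℕ, ∀ n, ∀ U ∈ C.B n, (K : ℝ) < d U → Metric.ediam U ≠ 0 →
      c * (Metric.ediam U).toReal ^ (((p : ℝ) + 1) / q - s) ≤ univGale C p s U := by
  classical
  obtain ⟨K, hK⟩ := exists_card_le C hd hpq
  obtain ⟨e, he⟩ := exists_code_enumerating (rePred_large C hdc K q) C.decidable_eq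
    (A := fun k => 2 ^ (p * k)) (by
    intro k S hS
    refine hK k S fun U hU => ?_
    obtain ⟨w, hw, rfl⟩ := hS U hU
    exact ⟨C.exists_mem w, hw⟩)
  refine ⟨(1 / 2) ^ (Encodable.encode e + 1 + (p + 1)), by positivity, K, fun n U hU hKU hU0 => ?_⟩
  have hUt := C.ediam_ne_top n U hU
  set D := (Metric.ediam U).toReal with hD
  have hD0 : 0 < D := ENNReal.toReal_pos hU0 hUt
  -- `k` is the least number with `2 ^ (-q * k) < D`
  have hex : ∃ k : ℕ, ((1 : ℝ) / 2) ^ (q * k) < D := by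
    obtain ⟨k, hk⟩ := exists_pow_lt_of_lt_one hD0 (show ((1 : ℝ) / 2) ^ q < 1 from
      pow_lt_one₀ (by norm_num) (by norm_num) hq)
    exact ⟨k, by rwa [pow_mul]⟩
  have hk := Nat.find_spec hex
  set k := Nat.find hex with hkdef
  have hD1 : D < 1 := by
    obtain ⟨ζ, hζ0, hζ1, hζ⟩ := C.small_size
    exact ((ENNReal.lt_ofReal_iff_toReal_lt hUt).1 (hζ n U hU)).trans_le
      (pow_le_one₀ hζ0.le hζ1.le)
  have hkpos : k ≠ 0 := by
    intro h
    rw [h, mul_zero, pow_zero] at hk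
    linarith
  have hk' : D ≤ (1 / 2) ^ (q * (k - 1)) :=
    not_lt.1 (Nat.find_min hex (Nat.sub_lt (Nat.pos_of_ne_zero hkpos) one_pos))
  obtain ⟨w, rfl⟩ := C.exists_name hU
  obtain ⟨i, hi, v, hv, hmem⟩ := he k w ⟨hKU, hk⟩
  have hcarry : CanCarry C.B n (C.δ w) := hd.canCarry C.uniqueParents C.ediam_ne_top hU (by
    intro h
    rw [h] at hKU
    exact absurd hKU (not_lt.2 (by simp))) hU0
  let N := Nat.pair (Encodable.encode e) (Nat.pair k i)
  have hN : UnivCollects C N (C.δ w) :=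
    ⟨v, by simpa [N] using hmem, hv ▸ hcarry.collects_self⟩
  have hωN : univWeight p N = 2⁻¹ ^ (Encodable.encode e + 1 + (p + 1) * k) := by
    simp [univWeight, N, hi]
  have h1 := le_mass (ω := univWeight p) hN
  rw [hωN] at h1
  have hmass : mass (univWeight p) (UnivCollects C) (C.δ w) ≠ ∞ :=
    ((mass_le _ _ _).trans_lt (tsum_univWeight_ne_top p).lt_top).ne
  have h2 := ENNReal.toReal_mono hmass h1
  have hval : ((univGale C p s (C.δ w) : ℝ≥0) : ℝ) =
      (mass (univWeight p) (UnivCollects C) (C.δ w)).toReal / D ^ (s : ℝ) := by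
    rw [hD, ENNReal.toReal_rpow, ← ENNReal.toReal_div]
    rfl
  rw [hval, Real.rpow_sub hD0, ← mul_div_assoc]
  refine div_le_div_of_nonneg_right ?_ (by positivity)
  refine le_trans ?_ h2
  rw [pow_add, mul_assoc]
  refine (mul_le_mul_of_nonneg_left (pow_half_mul_rpow_le hq hkpos hD0.le hk')
    (by positivity)).trans (le_of_eq ?_)
  simp [pow_add]

open Filter Topology in
/-- The universal supergale succeeds wherever some constructive supergale of smaller exponent
does. -/
theorem successSet_subset_univGale {t : ℝ≥0} {d : Set X → ℝ≥0} (hd : IsSupergale C.B t d)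
    (hdc : LowerSemicomputable fun w => d (C.δ w)) {q p : ℕ} (hq : q ≠ 0) {s : ℝ≥0}
    (hpq : (q : ℝ) * t + 1 ≤ p) (hps : (p : ℝ) + 1 < q * s) :
    successSet C.B d ⊆ successSet C.B (univGale C p s) := by
  rintro x ⟨w, hw, hlim⟩
  refine ⟨w, hw, ?_⟩
  obtain ⟨c, hc, K, hK⟩ := exists_le_univGale C hd hdc hq hpq s
  obtain ⟨ζ, hζ0, hζ1, hζ⟩ := C.small_size
  have hfreq : ∃ᶠ n in atTop, ((K : ℝ≥0) + d {x} : ℝ≥0) < d (w n) := by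
    have h : ∃ᶠ n in atTop, (((K : ℝ≥0) + d {x} : ℝ≥0) : ℝ≥0∞) < d (w n) :=
      frequently_lt_of_lt_limsup (by isBoundedDefault) (by rw [hlim]; exact ENNReal.coe_lt_top)
    exact h.mono fun n hn => by exact_mod_cast hn
  set η : ℝ := s - ((p : ℝ) + 1) / q with hη
  have hη0 : 0 < η := by
    have : (0 : ℝ) < q := by exact_mod_cast Nat.pos_of_ne_zero hq
    rw [hη, sub_pos, div_lt_iff₀ this, mul_comm]
    exact hps
  have hgrow : Tendsto (fun n : ℕ => c * (ζ ^ n) ^ (-η)) atTop atTop := by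
    have h1 : ∀ n : ℕ, (ζ ^ n) ^ (-η) = (ζ ^ (-η)) ^ n := fun n => by
      rw [← Real.rpow_natCast, ← Real.rpow_mul hζ0.le, mul_comm, Real.rpow_mul hζ0.le,
        Real.rpow_natCast]
    simp only [h1]
    exact (tendsto_pow_atTop_atTop_of_one_lt
      (Real.one_lt_rpow_of_pos_of_lt_one_of_neg hζ0 hζ1 (neg_lt_zero.2 hη0))).const_mul_atTop hc
  refine ENNReal.eq_top_of_forall_nnreal_le fun M => ?_
  refine le_limsup_of_frequently_le ?_ (by isBoundedDefault)
  refine (hfreq.and_eventually (hgrow.eventually_ge_atTop (M : ℝ))).mono fun n ⟨hn, hM⟩ => ?_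
  have hwn := hw.1 n
  have hxw : x ∈ w n := Set.mem_iInter.1 hw.2 n
  -- a set of diameter `0` containing `x` is `{x}`, and `d` takes only one value there
  have h0 : Metric.ediam (w n) ≠ 0 := by
    intro h
    have : w n = {x} := (Metric.ediam_eq_zero_iff.1 h).eq_singleton_of_mem hxw
    rw [this] at hn
    exact absurd hn (not_lt.2 le_add_self)
  have hKd : (K : ℝ) < d (w n) := by
    have : (K : ℝ≥0) < d (w n) := lt_of_le_of_lt le_self_add hn
    exact_mod_cast this
  have h1 := hK n (w n) hwn hKd h0
  have hfin := C.ediam_ne_top n _ hwn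
  have hD0 : 0 < (Metric.ediam (w n)).toReal := ENNReal.toReal_pos h0 hfin
  have hDζ : (Metric.ediam (w n)).toReal ≤ ζ ^ n :=
    ((ENNReal.lt_ofReal_iff_toReal_lt hfin).1 (hζ n _ hwn)).le
  have h2 : (M : ℝ) ≤ univGale C p s (w n) := by
    refine hM.trans (le_trans ?_ h1)
    rw [show ((p : ℝ) + 1) / q - s = -η by rw [hη]; ring]
    exact mul_le_mul_of_nonneg_left
      (Real.rpow_le_rpow_of_nonpos hD0 hDζ (neg_nonpos.2 hη0.le)) hc.le
  exact_mod_cast h2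

end Domination

/-! ### Absolute stability -/

section Stability

variable {X : Type*} [MetricSpace X] (C : ComputableNiceCover X)

theorem cdim_mono {A A' : Set X} (h : A ⊆ A') : cdim C A ≤ cdim C A' :=
  biInf_mono fun _ ⟨d, h1, h2, h3⟩ => ⟨d, h1, h2, h.trans h3⟩

/-- For any `t < s`, with `s` rational, a single constructive `s`-supergale succeeds at all points
of dimension less than `t`. -/
theorem mem_constrGales_of_cdimPt_lt {A : Set X} {t s : ℝ≥0} (hts : t < s) {a b : ℕ} (hb : b ≠ 0)
    (hs : (s : ℝ) = a / b) (hA : ∀ x ∈ A, cdimPt C x < t) : s ∈ constrGales C A := by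
  have hs0 : 0 < s := lt_of_le_of_lt zero_le hts
  have ha : a ≠ 0 := by
    rintro rfl
    rw [Nat.cast_zero, zero_div] at hs
    exact hs0.ne' (by exact_mod_cast hs)
  -- `3 < q * (s - t)` leaves room for `p` with `q * t + 1 ≤ p` and `p + 1 < q * s`
  obtain ⟨q, hq⟩ := exists_nat_gt (3 / ((s : ℝ) - t))
  have hts' : (0 : ℝ) < s - t := sub_pos.2 (by exact_mod_cast hts)
  have hq0 : (0 : ℝ) < q := lt_trans (by positivity) hq
  rw [div_lt_iff₀ hts'] at hq
  have hp1 : (q : ℝ) * t + 1 ≤ (⌈(q : ℝ) * t⌉₊ + 1 : ℕ) := by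
    push_cast
    linarith [Nat.le_ceil ((q : ℝ) * t)]
  have hp2 : ((⌈(q : ℝ) * t⌉₊ + 1 : ℕ) : ℝ) + 1 < q * s := by
    push_cast
    have := Nat.ceil_lt_add_one (show (0 : ℝ) ≤ q * t by positivity)
    nlinarith
  refine ⟨univGale C (⌈(q : ℝ) * t⌉₊ + 1) s, isSupergale_univGale C _ hs0,
    lowerSemicomputable_univGale C _ a b ha hb hs, fun x hx => ?_⟩
  have hlt := hA x hx
  simp only [cdimPt, cdim, iInf_lt_iff] at hlt
  obtain ⟨r, ⟨d, hd, hdc, hxd⟩, hrt⟩ := hlt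
  have hrt' : (r : ℝ) ≤ t := by
    have : r < t := by exact_mod_cast hrt
    exact_mod_cast this.le
  refine successSet_subset_univGale C hd hdc (by exact_mod_cast hq0.ne') (le_trans ?_ hp1) hp2
    (hxd rfl)
  gcongr

end Stability

end NiceCoverDim

theorem mainTheorem3 {X : Type*} [MetricSpace X] (C : NiceCoverDim.ComputableNiceCover X)
    (A : Set X) :
    NiceCoverDim.cdim C A = ⨆ x ∈ A, NiceCoverDim.cdimPt C x := by
  refine le_antisymm (le_of_forall_gt_imp_ge_of_dense fun β hβ => ?_)
    (iSup₂_le fun x hx => NiceCoverDim.cdim_mono C (Set.singleton_subset_iff.2 hx))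
  obtain ⟨t, ht, htβ⟩ := ENNReal.lt_iff_exists_nnreal_btwn.1 hβ
  obtain ⟨r, hr0, htr, hrβ⟩ := ENNReal.lt_iff_exists_rat_btwn.1 htβ
  have hts : t < Real.toNNReal r := by exact_mod_cast htr
  have hs : ((Real.toNNReal r : ℝ≥0) : ℝ) = (r.num.toNat : ℝ) / r.den := by
    have h1 : (r : ℝ) = r.num / r.den := Rat.cast_def r
    have h2 : ((r.num.toNat : ℤ) : ℝ) = r.num := by
      rw [Int.toNat_of_nonneg (Rat.num_nonneg.2 hr0)]
    rw [Real.coe_toNNReal _ (by exact_mod_cast hr0), h1, ← h2,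
      Int.cast_natCast]
  refine le_trans (iInf₂_le _ (NiceCoverDim.mem_constrGales_of_cdimPt_lt C hts r.den_nz hs
    fun x hx => ?_)) hrβ.le
  exact lt_of_le_of_lt (le_iSup₂ (f := fun x (_ : x ∈ A) => NiceCoverDim.cdimPt C x) x hx) ht
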